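/- Let $2<p<\infty$, let the scalar field $\mathbb K$ be $\mathbb R$ or $\mathbb C$, and let $X$ be a closed subspace of $\ell^p$ without the approximation property. Call a sequence $(x_n)_{n\ge1}$ in $X$ together with integers $0\le n_1<n_2<\cdots$ admissible if $\|x_n\|\le 1$ for all $n$, $\|x_n\|$ decreases to $0$, the identity operator of $X$ cannot be approximated uniformly on $\overline{\mathrm{conv}}\{x_n\}_{n\ge1}$ by finite rank operators, and $\|x_n\|<2^{-k}$ whenever $n>n_k$, $k\ge1$. For an admissible pair put $X_k=\mathrm{span}\{x_n:n\le n_k\}$ and, for $0<t<1$, $$V_t=\Big\{\sum_{k=1}^\infty \alpha_k\,\frac{a_k}{\|a_k\|^t}\ :\ a_k\in X_k,\ \|a_k\|\le 2^{-(k-1)},\ \sum_{k=1}^\infty|\alpha_k|^p\le 1\Big\}$$ (with $a_k/\|a_k\|^t=0$ if $a_k=0$). Let $W_t$ be the linear span of $V_t$, normed by $|||w|||_t=\inf\{\lambda>0:\lambda^{-1}w\in V_t\}$. Let $\mathcal Z^\sharp$ be the linear span of the functions $w\,\chi_{(s,t)}$ with $0<s<t<1$ and $w\in W_s$, with $$\|f\|=\Big(\int_0^1|||f(r)|||_r^p\,dr\Big)^{1/p},$$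 and let $Z^\sharp$ be the completion of $\mathcal Z^\sharp$ with respect to this norm (functions at distance zero being identified). Then admissible pairs exist, and for every admissible pair the Banach space $Z^\sharp$ has the metric compact approximation property (the identity can be approximated, uniformly on compact sets, by compact operators of norm at most one), and hence the compact approximation property, but it does not have the approximation property. Moreover, $Z^\sharp$ is reflexive. -/

import Mathlib

open Set Filter Topology MeasureTheory
open scoped Pointwise ENNReal

noncomputable section

namespace CompactApprox

/-! ### Approximation properties and reflexivity -/

section Properties

variable (𝕜 : Type*) [RCLike 𝕜] {Z : Type*} [NormedAddCommGroup Z] [NormedSpace 𝕜 Z]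

/-- The identity operator can be approximated, uniformly on the set `K`, by bounded operators of
finite rank. -/
def FiniteRankApproxOn (K : Set Z) : Prop :=
  ∀ ε : ℝ, 0 < ε → ∃ T : Z →L[𝕜] Z,
    FiniteDimensional 𝕜 (LinearMap.range (T : Z →ₗ[𝕜] Z)) ∧ ∀ z ∈ K, ‖T z - z‖ < ε

variable (Z)

/-- The approximation property. -/
def HasAP : Prop :=
  ∀ K : Set Z, IsCompact K → FiniteRankApproxOn 𝕜 K

/-- The compact approximation property. -/
def HasCompactAP : Prop :=
  ∀ K : Set Z, IsCompact K → ∀ ε : ℝ, 0 < ε →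
    ∃ T : Z →L[𝕜] Z, IsCompactOperator T ∧ ∀ z ∈ K, ‖T z - z‖ < ε

/-- The metric compact approximation property: the approximating compact operators can be chosen
with norm at most one. -/
def HasMetricCompactAP : Prop :=
  ∀ K : Set Z, IsCompact K → ∀ ε : ℝ, 0 < ε →
    ∃ T : Z →L[𝕜] Z, IsCompactOperator T ∧ ‖T‖ ≤ 1 ∧ ∀ z ∈ K, ‖T z - z‖ < ε

/-- Reflexivity: the canonical embedding into the bidual is onto. -/
def IsReflexiveSpace : Prop :=
  Function.Surjective (NormedSpace.inclusionInDoubleDual 𝕜 Z)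

end Properties

/-! ### The data of the construction -/

section Data

variable (𝕜 : Type*) [RCLike 𝕜] {E : Type*} [NormedAddCommGroup E] [NormedSpace 𝕜 E]

/-- The finite dimensional spaces `X_k = span {x_n : n < N k}`. Here and below sequences are
indexed from `0`. -/
def spanUpTo (x : ℕ → E) (N : ℕ → ℕ) (k : ℕ) : Submodule 𝕜 E :=
  Submodule.span 𝕜 (x '' {n | n < N k})

/-- The sequences from which the space is built: `‖x n‖ ≤ 1`, `‖x n‖` decreases to zero, the
identity cannot be approximated by finite rank operators on the closed convex hull of the `x n`,
and the integers `N 0 < N 1 < ⋯` are such that `‖x n‖ < (1/2)^(k+1)` for all `n ≥ N k`. -/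
structure IsAdmissible [NormedSpace ℝ E] (x : ℕ → E) (N : ℕ → ℕ) : Prop where
  norm_le_one : ∀ n, ‖x n‖ ≤ 1
  antitone : Antitone fun n => ‖x n‖
  tendsto_zero : Tendsto (fun n => ‖x n‖) atTop (𝓝 0)
  not_approx : ¬ FiniteRankApproxOn 𝕜 (closure (convexHull ℝ (range x)))
  strictMono : StrictMono N
  norm_lt : ∀ k n, N k ≤ n → ‖x n‖ < (1 / 2 : ℝ) ^ (k + 1)

end Data

/-! ### The sets `V_t`, the spaces `W_t`, and their norms -/

section Sets

variable {𝕜 : Type*} [RCLike 𝕜] {E : Type*} [NormedAddCommGroup E] [NormedSpace 𝕜 E]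
  [NormedSpace ℝ E]

/-- The set `V_t` of all sums `∑ α_k a_k / ‖a_k‖^t` with `a_k ∈ X_k`, `‖a_k‖ ≤ (1/2)^k` and
`∑ |α_k|^p ≤ 1` (the summand is zero if `a_k = 0`). -/
def setV (X : ℕ → Submodule 𝕜 E) (p t : ℝ) : Set E :=
  {w | ∃ (α : ℕ → 𝕜) (a : ℕ → E),
    (∀ k, a k ∈ X k) ∧ (∀ k, ‖a k‖ ≤ (1 / 2 : ℝ) ^ k) ∧
    Summable (fun k => ‖α k‖ ^ p) ∧ ∑' k, ‖α k‖ ^ p ≤ 1 ∧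
    HasSum (fun k => α k • ((‖a k‖ ^ t)⁻¹ • a k)) w}

/-- The linear span `W_t` of `V_t`. -/
def spaceW (X : ℕ → Submodule 𝕜 E) (p t : ℝ) : Submodule 𝕜 E :=
  Submodule.span 𝕜 (setV X p t)

/-- The norm of `W_t`, that is, the Minkowski functional of `V_t`. -/
def normW (X : ℕ → Submodule 𝕜 E) (p t : ℝ) (w : E) : ℝ :=
  gauge (setV X p t) w

variable {X : ℕ → Submodule 𝕜 E} {p s t : ℝ}

lemma normW_nonneg (w : E) : 0 ≤ normW X p t w := gauge_nonneg w

lemma zero_mem_setV (hp : 1 ≤ p) : (0 : E) ∈ setV X p t := by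
  have h0 : (0 : ℝ) ^ p = 0 := Real.zero_rpow (by linarith)
  refine ⟨0, 0, fun k => (X k).zero_mem, fun k => ?_, ?_, ?_, ?_⟩
  · simp
  · simp [h0]
  · simp [h0]
  · simp

lemma balanced_setV (hp : 1 ≤ p) : Balanced 𝕜 (setV X p t) := by
  rw [balanced_iff_smul_mem]
  rintro c hc w ⟨α, a, h1, h2, h3, h4, h5⟩
  have hle : ∀ k, ‖c * α k‖ ^ p ≤ ‖α k‖ ^ p := fun k => by
    gcongr
    rw [norm_mul]
    exact mul_le_of_le_one_left (norm_nonneg _) hc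
  have hs : Summable fun k => ‖c * α k‖ ^ p :=
    Summable.of_nonneg_of_le (fun k => by positivity) hle h3
  refine ⟨fun k => c * α k, a, h1, h2, hs, (hs.tsum_le_tsum hle h3).trans h4, ?_⟩
  simpa only [mul_smul] using h5.const_smul c

variable [IsScalarTower ℝ 𝕜 E]

/-- With `b = a / ‖a‖^t`, the vectors allowed in `V_t` are those with `‖b‖ ≤ ρ^(1-t)`. -/
lemma exists_rescale (ht1 : t < 1) {ρ : ℝ} (hρ : 0 ≤ ρ) (F : Submodule 𝕜 E) (b : E) :
    (b ∈ F ∧ ‖b‖ ≤ ρ ^ (1 - t)) ↔ ∃ a ∈ F, ‖a‖ ≤ ρ ∧ (‖a‖ ^ t)⁻¹ • a = b := by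
  have h1t : 0 < 1 - t := by linarith
  constructor
  · rintro ⟨hb, hbρ⟩
    rcases eq_or_ne b 0 with rfl | hb0
    · exact ⟨0, F.zero_mem, by simpa using hρ, by simp⟩
    have hn : 0 < ‖b‖ := norm_pos_iff.2 hb0
    have hna : ‖‖b‖ ^ (t / (1 - t)) • b‖ = ‖b‖ ^ (1 / (1 - t)) := by
      rw [norm_smul, Real.norm_of_nonneg (by positivity)]
      conv_lhs => rw [← Real.rpow_one ‖b‖, ← Real.rpow_mul (by positivity), ← Real.rpow_add hn]
      congr 1
      field_simp
      ring
    refine ⟨‖b‖ ^ (t / (1 - t)) • b, ?_, ?_, ?_⟩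
    · rw [← algebraMap_smul 𝕜]
      exact F.smul_mem _ hb
    · rw [hna]
      calc ‖b‖ ^ (1 / (1 - t)) ≤ (ρ ^ (1 - t)) ^ (1 / (1 - t)) := by gcongr
        _ = ρ := by rw [← Real.rpow_mul hρ, mul_one_div_cancel h1t.ne', Real.rpow_one]
    · rw [hna, smul_smul, ← Real.rpow_mul hn.le, ← Real.rpow_neg hn.le, ← Real.rpow_add hn]
      have : -(1 / (1 - t) * t) + t / (1 - t) = 0 := by field_simp; ring
      rw [this, Real.rpow_zero, one_smul]
  · rintro ⟨a, ha, haρ, rfl⟩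
    refine ⟨?_, ?_⟩
    · rw [← algebraMap_smul 𝕜]
      exact F.smul_mem _ ha
    rcases eq_or_ne a 0 with rfl | ha0
    · simp only [norm_zero, smul_zero]; positivity
    have hn : 0 < ‖a‖ := norm_pos_iff.2 ha0
    rw [norm_smul, Real.norm_of_nonneg (by positivity), ← Real.rpow_neg hn.le]
    calc ‖a‖ ^ (-t) * ‖a‖ = ‖a‖ ^ (1 - t) := by
          conv_lhs => rw [← Real.rpow_one ‖a‖, ← Real.rpow_mul hn.le, ← Real.rpow_add hn]
          congr 1; ring
      _ ≤ ρ ^ (1 - t) := by gcongr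

lemma mem_setV_iff (ht1 : t < 1) (w : E) :
    w ∈ setV X p t ↔ ∃ (α : ℕ → 𝕜) (b : ℕ → E),
      (∀ k, b k ∈ X k ∧ ‖b k‖ ≤ ((1 / 2 : ℝ) ^ k) ^ (1 - t)) ∧
      Summable (fun k => ‖α k‖ ^ p) ∧ ∑' k, ‖α k‖ ^ p ≤ 1 ∧
      HasSum (fun k => α k • b k) w := by
  constructor
  · rintro ⟨α, a, h1, h2, h3, h4, h5⟩
    exact ⟨α, fun k => (‖a k‖ ^ t)⁻¹ • a k,
      fun k => (exists_rescale ht1 (by positivity) (X k) _).2 ⟨a k, h1 k, h2 k, rfl⟩,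
      h3, h4, h5⟩
  · rintro ⟨α, b, h1, h3, h4, h5⟩
    have := fun k => (exists_rescale ht1 (by positivity) (X k) _).1 (h1 k)
    choose a ha1 ha2 ha3 using this
    exact ⟨α, a, ha1, ha2, h3, h4, by simpa only [ha3] using h5⟩

lemma setV_mono (hst : s ≤ t) (ht : t < 1) : setV X p s ⊆ setV X p t := by
  intro w hw
  rw [mem_setV_iff (hst.trans_lt ht)] at hw
  rw [mem_setV_iff ht]
  obtain ⟨α, b, h1, h⟩ := hw
  refine ⟨α, b, fun k => ⟨(h1 k).1, (h1 k).2.trans ?_⟩, h⟩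
  exact Real.rpow_le_rpow_of_exponent_ge (by positivity) (pow_le_one₀ (by norm_num) (by norm_num))
    (by linarith)

lemma convex_setV (hp : 1 ≤ p) (ht0 : 0 < t) (ht1 : t < 1) : Convex ℝ (setV X p t) := by
  intro v hv w hw l m hl hm hlm
  rw [mem_setV_iff ht1] at hv hw ⊢
  obtain ⟨α, b, h1, h3, h4, h5⟩ := hv
  obtain ⟨β, c, g1, g3, g4, g5⟩ := hw
  set γ : ℕ → ℝ := fun k => l * ‖α k‖ + m * ‖β k‖ with hγ
  have hγ0 : ∀ k, 0 ≤ γ k := fun k => by positivity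
  have hγp : ∀ k, γ k ^ p ≤ l * ‖α k‖ ^ p + m * ‖β k‖ ^ p := fun k => by
    simpa using (convexOn_rpow hp).2 (norm_nonneg (α k)) (norm_nonneg (β k)) hl hm hlm
  have hS : Summable fun k => l * ‖α k‖ ^ p + m * ‖β k‖ ^ p :=
    (h3.mul_left l).add (g3.mul_left m)
  have hn : ∀ k, ‖((γ k : ℝ) : 𝕜)‖ = γ k := fun k => by
    rw [RCLike.norm_ofReal, abs_of_nonneg (hγ0 k)]
  have hS' : Summable fun k => ‖((γ k : ℝ) : 𝕜)‖ ^ p := by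
    simp only [hn]
    exact Summable.of_nonneg_of_le (fun k => Real.rpow_nonneg (hγ0 k) _) hγp hS
  have key : ∀ k, ‖l • α k • b k + m • β k • c k‖ ≤ γ k * ((1 / 2 : ℝ) ^ k) ^ (1 - t) := fun k => by
    refine (norm_add_le _ _).trans ?_
    simp only [norm_smul, Real.norm_of_nonneg hl, Real.norm_of_nonneg hm, hγ]
    have e1 := mul_le_mul_of_nonneg_left (h1 k).2 (show 0 ≤ l * ‖α k‖ by positivity)
    have e2 := mul_le_mul_of_nonneg_left (g1 k).2 (show 0 ≤ m * ‖β k‖ by positivity)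
    linarith
  have hmem : ∀ k, l • α k • b k + m • β k • c k ∈ X k := fun k => by
    rw [← algebraMap_smul 𝕜 l, ← algebraMap_smul 𝕜 m]
    exact (X k).add_mem ((X k).smul_mem _ ((X k).smul_mem _ (h1 k).1))
      ((X k).smul_mem _ ((X k).smul_mem _ (g1 k).1))
  refine ⟨fun k => (γ k : 𝕜), fun k => ((γ k : ℝ) : 𝕜)⁻¹ • (l • α k • b k + m • β k • c k),
    fun k => ⟨(X k).smul_mem _ (hmem k), ?_⟩, hS', ?_, ?_⟩
  · rw [norm_smul, norm_inv, hn]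
    rcases (hγ0 k).eq_or_lt with h | h
    · rw [← h]; simp only [inv_zero, zero_mul]; positivity
    · rw [inv_mul_le_iff₀ h]; exact key k
  · simp only [hn] at hS' ⊢
    refine (hS'.tsum_le_tsum hγp hS).trans ?_
    rw [(h3.mul_left l).tsum_add (g3.mul_left m), tsum_mul_left, tsum_mul_left]
    nlinarith
  · have := (h5.const_smul l).add (g5.const_smul m)
    refine this.congr_fun fun k => ?_
    rcases (hγ0 k).eq_or_lt with h | h
    · have := key k
      rw [← h, zero_mul, norm_le_zero_iff] at this
      simp only [this, smul_zero]
    · have h' : ((γ k : ℝ) : 𝕜) ≠ 0 := by exact_mod_cast h.ne'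
      exact smul_inv_smul₀ h' _

/-- Every element of `W_t` lies in a multiple of `V_t`. -/
lemma exists_mem_smul_setV (hp : 1 ≤ p) (ht0 : 0 < t) (ht1 : t < 1) {w : E}
    (hw : w ∈ spaceW X p t) : ∃ r : ℝ, 0 < r ∧ w ∈ r • setV X p t := by
  have hc := convex_setV (X := X) hp ht0 ht1
  induction hw using Submodule.span_induction with
  | mem v hv => exact ⟨1, one_pos, by simpa using hv⟩
  | zero => exact ⟨1, one_pos, by simpa using zero_mem_setV hp⟩
  | add v w _ _ hv hw =>
    obtain ⟨r, hr, hv⟩ := hv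
    obtain ⟨r', hr', hw⟩ := hw
    refine ⟨r + r', by positivity, ?_⟩
    rw [hc.add_smul hr.le hr'.le]
    exact Set.add_mem_add hv hw
  | smul c v _ hv =>
    obtain ⟨r, hr, u, hu, rfl⟩ := hv
    refine ⟨(‖c‖ + 1) * r, by positivity, ?_⟩
    rw [mem_smul_set_iff_inv_smul_mem₀ (by positivity)]
    have hcn : 0 < ‖c‖ + 1 := by positivity
    have : ((‖c‖ + 1) * r)⁻¹ • c • r • u = (((‖c‖ + 1)⁻¹ : ℝ) : 𝕜) • c • u := by
      rw [← algebraMap_smul 𝕜 (((‖c‖ + 1) * r)⁻¹), ← algebraMap_smul 𝕜 r u]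
      simp only [smul_smul]
      congr 1
      have hr' : (r : 𝕜) ≠ 0 := by exact_mod_cast hr.ne'
      simp only [RCLike.algebraMap_eq_ofReal, RCLike.ofReal_inv, RCLike.ofReal_mul, mul_inv]
      field_simp
    change ((‖c‖ + 1) * r)⁻¹ • c • r • u ∈ _
    rw [this, smul_smul]
    refine balanced_iff_smul_mem.1 (balanced_setV (𝕜 := 𝕜) hp) ?_ hu
    rw [norm_mul, RCLike.norm_ofReal, abs_of_pos (by positivity), inv_mul_le_iff₀ hcn]
    linarith

lemma normW_add_le (hp : 1 ≤ p) (ht0 : 0 < t) (ht1 : t < 1) {v w : E}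
    (hv : v ∈ spaceW X p t) (hw : w ∈ spaceW X p t) :
    normW X p t (v + w) ≤ normW X p t v + normW X p t w := by
  refine le_of_forall_pos_lt_add fun ε hε => ?_
  obtain ⟨a, ⟨ha, hva⟩, ha'⟩ := exists_lt_of_csInf_lt (exists_mem_smul_setV hp ht0 ht1 hv)
    (lt_add_of_pos_right (normW X p t v) (half_pos hε))
  obtain ⟨b, ⟨hb, hwb⟩, hb'⟩ := exists_lt_of_csInf_lt (exists_mem_smul_setV hp ht0 ht1 hw)
    (lt_add_of_pos_right (normW X p t w) (half_pos hε))
  have h : v + w ∈ (a + b) • setV X p t := by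
    rw [(convex_setV hp ht0 ht1).add_smul ha.le hb.le]
    exact Set.add_mem_add hva hwb
  have := gauge_le_of_mem (by positivity) h
  unfold normW at *
  linarith

lemma normW_smul (hp : 1 ≤ p) (c : 𝕜) (w : E) : normW X p t (c • w) = ‖c‖ * normW X p t w :=
  gauge_smul (balanced_setV hp) c w

lemma spaceW_mono (hst : s ≤ t) (ht : t < 1) : spaceW X p s ≤ spaceW X p t :=
  Submodule.span_mono (setV_mono hst ht)

lemma normW_anti (hp : 1 ≤ p) (hs : 0 < s) (hst : s ≤ t) (ht : t < 1) {w : E}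
    (hw : w ∈ spaceW X p s) : normW X p t w ≤ normW X p s w := by
  refine csInf_le_csInf ⟨0, fun r hr => hr.1.le⟩ (exists_mem_smul_setV hp hs (hst.trans_lt ht) hw) ?_
  rintro r ⟨hr, hr'⟩
  exact ⟨hr, Set.smul_set_mono (setV_mono hst ht) hr'⟩

/-- For fixed `w` the function `r ↦ |||w|||_r` is measurable on `(0,1)`. -/
lemma measurable_normW (hp : 1 ≤ p) (w : E) :
    Measurable fun r : Ioo (0 : ℝ) 1 => normW X p r w := by
  have hup : MeasurableSet {r : Ioo (0 : ℝ) 1 | w ∈ spaceW X p r} := by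
    refine OrdConnected.measurableSet ⟨fun a ha b _ c hc => ?_⟩
    exact spaceW_mono hc.1 c.2.2 ha
  refine measurable_of_restrict_of_restrict_compl hup ?_ ?_
  · refine Antitone.measurable fun a b hab => ?_
    exact normW_anti hp a.1.2.1 hab b.1.2.2 a.2
  · convert measurable_const (a := (0 : ℝ)) using 1
    ext r
    have hr : w ∉ spaceW X p r.1 := r.2
    have : {c : ℝ | 0 < c ∧ w ∈ c • setV X p r.1} = ∅ := by
      ext c
      simp only [mem_ofPred_eq, mem_empty_iff_false, iff_false, not_and]
      rintro hc ⟨u, hu, rfl⟩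
      apply hr
      change c • u ∈ _
      rw [← algebraMap_smul 𝕜 c u]
      exact Submodule.smul_mem _ _ (Submodule.subset_span hu)
    change sInf {c : ℝ | 0 < c ∧ w ∈ c • setV X p r.1} = 0
    rw [this, Real.sInf_empty]

end Sets

/-! ### The function space and its completion -/

section Space

variable {𝕜 : Type*} [RCLike 𝕜] {E : Type*} [NormedAddCommGroup E] [NormedSpace 𝕜 E]
  [NormedSpace ℝ E]

/-- The linear span of the functions `w χ_(s,t)` with `0 < s < t < 1` and `w ∈ W_s`, as functions
on the line that vanish off `(0,1)`. -/
def stepFunctions (X : ℕ → Submodule 𝕜 E) (p : ℝ) : Submodule 𝕜 (ℝ → E) :=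
  Submodule.span 𝕜 {f | ∃ s t : ℝ, ∃ w : E, 0 < s ∧ s < t ∧ t < 1 ∧ w ∈ spaceW X p s ∧
    f = (Ioo s t).indicator fun _ => w}

/-- The space of step functions as a type of its own, so that it carries only the norm defined
below. -/
def PreZ (X : ℕ → Submodule 𝕜 E) (p : ℝ) : Type _ := stepFunctions X p

variable {X : ℕ → Submodule 𝕜 E} {p : ℝ}

instance : AddCommGroup (PreZ X p) := inferInstanceAs (AddCommGroup (stepFunctions X p))

instance : Module 𝕜 (PreZ X p) := inferInstanceAs (Module 𝕜 (stepFunctions X p))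

/-- The function underlying an element of the space. -/
def PreZ.toFun (f : PreZ X p) : ℝ → E := Subtype.val (p := fun g => g ∈ stepFunctions X p) f

/-- `‖f‖ = (∫_0^1 |||f(r)|||_r^p dr)^(1/p)`. -/
instance : Norm (PreZ X p) where
  norm f := (∫ r in Ioo (0 : ℝ) 1, normW X p r (f.toFun r) ^ p) ^ (1 / p)

lemma PreZ.norm_def (f : PreZ X p) :
    ‖f‖ = (∫ r in Ioo (0 : ℝ) 1, normW X p r (f.toFun r) ^ p) ^ (1 / p) := rfl

lemma PreZ.toFun_mem (f : PreZ X p) : f.toFun ∈ stepFunctions X p :=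
  Subtype.prop (p := fun g => g ∈ stepFunctions X p) f

lemma PreZ.toFun_add (f g : PreZ X p) (r : ℝ) : (f + g).toFun r = f.toFun r + g.toFun r := rfl

lemma PreZ.toFun_smul (c : 𝕜) (f : PreZ X p) (r : ℝ) : (c • f).toFun r = c • f.toFun r := rfl

variable [IsScalarTower ℝ 𝕜 E]

/-- A step function takes finitely many values on measurable sets, `f(r) ∈ W_r` for all `r`, and
`|||f(r)|||_r` is bounded. -/
lemma stepFunctions_props (hp : 1 ≤ p) {f : ℝ → E} (hf : f ∈ stepFunctions X p) :
    (∃ F : SimpleFunc ℝ E, ⇑F = f) ∧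
    (∀ r ∈ Ioo (0 : ℝ) 1, f r ∈ spaceW X p r) ∧
    ∃ C : ℝ, ∀ r ∈ Ioo (0 : ℝ) 1, normW X p r (f r) ≤ C := by
  have h0 : ∀ r : ℝ, normW X p r 0 = 0 := fun r => gauge_zero
  induction hf using Submodule.span_induction with
  | mem f hf =>
    obtain ⟨s, t, w, hs, hst, ht, hw, rfl⟩ := hf
    refine ⟨⟨(SimpleFunc.const ℝ w).restrict (Ioo s t), ?_⟩, fun r hr => ?_, normW X p s w,
      fun r hr => ?_⟩
    · rw [SimpleFunc.coe_restrict _ measurableSet_Ioo]; rfl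
    · by_cases h : r ∈ Ioo s t
      · rw [indicator_of_mem h]; exact spaceW_mono h.1.le hr.2 hw
      · rw [indicator_of_notMem h]; exact Submodule.zero_mem _
    · by_cases h : r ∈ Ioo s t
      · rw [indicator_of_mem h]; exact normW_anti hp hs h.1.le hr.2 hw
      · rw [indicator_of_notMem h, h0]; exact normW_nonneg _
  | zero =>
    exact ⟨⟨SimpleFunc.const ℝ 0, rfl⟩, fun r _ => Submodule.zero_mem _, 0, fun r _ => (h0 r).le⟩
  | add f g _ _ hf hg =>
    obtain ⟨⟨F, rfl⟩, hF, C, hC⟩ := hf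
    obtain ⟨⟨G, rfl⟩, hG, D, hD⟩ := hg
    refine ⟨⟨F + G, rfl⟩, fun r hr => Submodule.add_mem _ (hF r hr) (hG r hr), C + D,
      fun r hr => ?_⟩
    exact (normW_add_le hp hr.1 hr.2 (hF r hr) (hG r hr)).trans (add_le_add (hC r hr) (hD r hr))
  | smul c f _ hf =>
    obtain ⟨⟨F, rfl⟩, hF, C, hC⟩ := hf
    refine ⟨⟨F.map (c • ·), rfl⟩, fun r hr => Submodule.smul_mem _ _ (hF r hr), ‖c‖ * C,
      fun r hr => ?_⟩
    rw [Pi.smul_apply, normW_smul hp]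
    exact mul_le_mul_of_nonneg_left (hC r hr) (norm_nonneg _)

/-- The function `r ↦ |||f(r)|||_r` belongs to `L^p(0,1)`. -/
lemma PreZ.memLp (hp : 1 ≤ p) (f : PreZ X p) :
    MemLp (fun r => normW X p r (f.toFun r)) (ENNReal.ofReal p)
      (volume.restrict (Ioo (0 : ℝ) 1)) := by
  obtain ⟨⟨F, hF⟩, -, C, hC⟩ := stepFunctions_props hp f.toFun_mem
  rw [← hF] at hC ⊢
  have hm : Measurable fun r : Ioo (0 : ℝ) 1 => normW X p r (F r) := by
    have : (fun r : Ioo (0 : ℝ) 1 => normW X p r (F r)) =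
        fun r => ∑ w ∈ F.range, {r : Ioo (0 : ℝ) 1 | F r = w}.indicator
          (fun r => normW X p r w) r := by
      ext r
      rw [Finset.sum_eq_single (F r)]
      · simp
      · intro w _ hw
        exact indicator_of_notMem (fun h => hw h.symm) _
      · intro h
        exact absurd (F.mem_range_self r) h
    rw [this]
    refine Finset.measurable_sum _ fun w _ => (measurable_normW hp w).indicator ?_
    exact measurable_subtype_coe (F.measurableSet_fiber w)
  have hae : AEStronglyMeasurable (fun r => normW X p r (F r))
      (volume.restrict (Ioo (0 : ℝ) 1)) := by
    have h1 : AEMeasurable (fun r => normW X p r (F r)) (volume.restrict (Ioo (0 : ℝ) 1)) := by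
      rw [aemeasurable_restrict_iff_comap_subtype measurableSet_Ioo]
      exact hm.aemeasurable
    exact h1.aestronglyMeasurable
  refine MemLp.of_bound hae C ?_
  refine (ae_restrict_iff' measurableSet_Ioo).2 (Eventually.of_forall fun r hr => ?_)
  rw [Real.norm_of_nonneg (normW_nonneg _)]
  exact hC r hr

lemma PreZ.norm_eq_toReal_eLpNorm (hp : 1 ≤ p) (f : PreZ X p) :
    ‖f‖ = (eLpNorm (fun r => normW X p r (f.toFun r)) (ENNReal.ofReal p)
      (volume.restrict (Ioo (0 : ℝ) 1))).toReal := by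
  have hp0 : 0 < p := by linarith
  rw [(PreZ.memLp hp f).eLpNorm_eq_integral_rpow_norm (by simpa using hp0) ENNReal.ofReal_ne_top,
    ENNReal.toReal_ofReal (by positivity), ENNReal.toReal_ofReal hp0.le, PreZ.norm_def]
  simp only [Real.norm_of_nonneg (normW_nonneg _), one_div]

lemma PreZ.seminorm_core (hp : 1 ≤ p) : SeminormedSpace.Core 𝕜 (PreZ X p) where
  norm_nonneg f := by
    rw [PreZ.norm_eq_toReal_eLpNorm hp]; exact ENNReal.toReal_nonneg
  norm_smul c f := by
    simp only [PreZ.norm_eq_toReal_eLpNorm hp, PreZ.toFun_smul, normW_smul hp]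
    rw [show (fun r => ‖c‖ * normW X p r (f.toFun r)) =
      ‖c‖ • fun r => normW X p r (f.toFun r) from rfl, eLpNorm_const_smul, ENNReal.toReal_mul]
    simp
  norm_triangle f g := by
    simp only [PreZ.norm_eq_toReal_eLpNorm hp]
    have hf := PreZ.memLp hp f
    have hg := PreZ.memLp hp g
    rw [← ENNReal.toReal_add hf.2.ne hg.2.ne]
    refine ENNReal.toReal_mono (ENNReal.add_ne_top.2 ⟨hf.2.ne, hg.2.ne⟩) ?_
    refine le_trans ?_ (eLpNorm_add_le hf.1 hg.1 (by simpa using hp))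
    refine eLpNorm_mono_ae ((ae_restrict_iff' measurableSet_Ioo).2
      (Eventually.of_forall fun r hr => ?_))
    rw [Pi.add_apply, Real.norm_of_nonneg (normW_nonneg _),
      Real.norm_of_nonneg (add_nonneg (normW_nonneg _) (normW_nonneg _)), PreZ.toFun_add]
    exact normW_add_le hp hr.1 hr.2 ((stepFunctions_props hp f.toFun_mem).2.1 r hr)
      ((stepFunctions_props hp g.toFun_mem).2.1 r hr)

variable [hp : Fact (2 < p)]

instance : SeminormedAddCommGroup (PreZ X p) :=
  SeminormedAddCommGroup.ofCore (PreZ.seminorm_core (one_le_two.trans hp.out.le))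

instance : NormedSpace 𝕜 (PreZ X p) where
  norm_smul_le c f :=
    ((PreZ.seminorm_core (X := X) (one_le_two.trans hp.out.le)).norm_smul c f).le

variable (𝕜 p)

/-- The Banach space built from the sequences `x` and `N`: the completion of the space of step
functions (step functions at distance zero are identified). -/
abbrev ZSharp (x : ℕ → E) (N : ℕ → ℕ) : Type _ :=
  UniformSpace.Completion (PreZ (spanUpTo 𝕜 x N) p)

end Space

instance fact_one_le_ofReal {p : ℝ} [hp : Fact (2 < p)] : Fact (1 ≤ ENNReal.ofReal p) :=
  ⟨by simpa using one_le_two.trans hp.out.le⟩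

end CompactApprox

end

set_option linter.unusedSectionVars false

/-! Write ρ_k(t) = 2^(-k(1-t)) (`radiusV`). The norm of W_t is the infimum of (∑ (‖b_k‖ /
ρ_k(t))^p)^(1/p) over all decompositions w = ∑ b_k with b_k ∈ X_k (`normW_rpow_le_tsum`,
`exists_hasSum_of_normW_lt`). So W_t is a quotient of a weighted ℓ^p-sum of the X_k. The norms
decrease in t, and for s < t the ratio ρ_k(s)/ρ_k(t) = 2^(-k(t-s)) decays geometrically. Tails of
decompositions are therefore small in W_t, and since the X_k are finite dimensional the inclusion
W_s → W_t is compact (`exists_head_of_normW_lt`).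

Reflexivity. For p ≥ 2 Clarkson's inequality holds for scalars. Every step of the construction
preserves it: ℓ^p-sums, subspaces, the quotients W_t (`normW_clarkson`), the L^p-norm in r,
completion. It implies uniform convexity, and Milman–Pettis applies.

Metric compact approximation. Cut (0,1) into m + 3 equal cells, average a function over each of the
first m cells, and put the average two cells further right (`PreZ.gridMap`). The idle cell between
source and target makes each block factor through a compact inclusion W_b → W_s with b < s. Moving
right decreases the norms, so Jensen's inequality gives norm at most one, and step functions are
recovered as m → ∞ by dominated convergence.

Failure of the approximation property. The functions x_n χ_(1/4,1/2) form a null sequence in the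
space, and four times the integral over (1/4,1/2) is a bounded operator Φ taking them back to x_n.
If finite rank operators T approximated the identity on this sequence, Φ T would do so for the x_n,
except that the lift x_n ↦ x_n χ_(1/4,1/2) is not known to be bounded from E. It is however
continuous at 0 on the absolutely convex hull of the x_n
(`IsAdmissible.normW_linearCombination_le`). By Hahn–Banach this suffices to replace the functionals
of T by functionals on E (`ControlsCombinations.exists_functional`), which contradicts
admissibility.

Admissible pairs exist because a compact set lies in the closed convex hull of a null sequence,
whose norms can be enlarged to a decreasing sequence. -/

noncomputable section

namespace CompactApprox

/-! ### Separation of points from balanced convex sets. -/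

section Separation

variable {𝕜 : Type*} [RCLike 𝕜] {F : Type*} [NormedAddCommGroup F] [NormedSpace 𝕜 F]
  [NormedSpace ℝ F] [IsScalarTower ℝ 𝕜 F]

/-- A point outside the closure of a balanced convex set is separated from it by a functional. -/
lemma exists_functional_of_notMem_closure {s : Set F} (hc : Convex ℝ s) (hb : Balanced 𝕜 s)
    (h0 : (0 : F) ∈ s) {x : F} (hx : x ∉ closure s) :
    ∃ f : F →L[𝕜] 𝕜, (∀ a ∈ s, ‖f a‖ ≤ 1) ∧ 1 < ‖f x‖ := by
  obtain ⟨f, u, hu, hux⟩ :=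
    RCLike.geometric_hahn_banach_closed_point (𝕜 := 𝕜) hc.closure isClosed_closure hx
  have hu0 : 0 < u := by simpa using hu 0 (subset_closure h0)
  have hs : ∀ a ∈ s, ‖f a‖ ≤ u := fun a ha => by
    -- A unimodular c rotates f a onto its modulus, so a bound on real parts over a balanced set
    -- bounds absolute values.
    obtain ⟨c, hc1, hc⟩ := RCLike.exists_norm_eq_mul_self (f a)
    have := hu (c • a) (subset_closure (balanced_iff_smul_mem.1 hb hc1.le ha))
    rw [map_smul, smul_eq_mul, ← hc, RCLike.ofReal_re] at this
    exact this.le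
  refine ⟨((u⁻¹ : ℝ) : 𝕜) • f, fun a ha => ?_, ?_⟩
  · rw [smul_apply, norm_smul, RCLike.norm_ofReal,
      abs_of_pos (inv_pos.2 hu0), inv_mul_le_iff₀ hu0, mul_one]
    exact hs a ha
  · rw [smul_apply, norm_smul, RCLike.norm_ofReal,
      abs_of_pos (inv_pos.2 hu0), lt_inv_mul_iff₀ hu0, mul_one]
    exact hux.trans_le (RCLike.re_le_norm _)

end Separation

/-! ### Helly, Goldstine and Milman–Pettis. -/

section Reflexivity

variable {𝕜 : Type*} [RCLike 𝕜] {Z : Type*} [NormedAddCommGroup Z] [NormedSpace 𝕜 Z]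

/-- Helly's lemma. -/
lemma mem_closure_image_closedBall {ι : Type*} [Fintype ι]
    (φ : StrongDual 𝕜 (StrongDual 𝕜 Z)) (hφ : ‖φ‖ ≤ 1) (f : ι → StrongDual 𝕜 Z) :
    (fun i => φ (f i)) ∈ closure ((fun z i => f i z) '' Metric.closedBall (0 : Z) 1) := by
  classical
  let : NormedSpace ℝ Z := NormedSpace.restrictScalars ℝ 𝕜 Z
  by_contra hx
  let J : Z →ₗ[𝕜] (ι → 𝕜) := LinearMap.pi fun i => (f i : Z →ₗ[𝕜] 𝕜)
  have hJ : (fun z i => f i z) '' Metric.closedBall (0 : Z) 1 = J '' Metric.closedBall 0 1 := rfl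
  rw [hJ] at hx
  obtain ⟨g, hg, hg'⟩ := exists_functional_of_notMem_closure (𝕜 := 𝕜)
    ((convex_closedBall (0 : Z) 1).is_linear_image ⟨J.map_add, fun c z => by
      rw [← algebraMap_smul 𝕜 c z, map_smul, algebraMap_smul]⟩)
    (by
      rw [balanced_iff_smul_mem]
      rintro c hc _ ⟨z, hz, rfl⟩
      refine ⟨c • z, ?_, map_smul _ _ _⟩
      rw [mem_closedBall_zero_iff] at hz ⊢
      rw [norm_smul]
      exact mul_le_one₀ hc (norm_nonneg _) hz)
    ⟨0, by simp, map_zero _⟩ hx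
  have hgv : ∀ v : ι → 𝕜, g v = ∑ i, v i * g (Pi.single i 1) := fun v => by
    conv_lhs => rw [← Finset.univ_sum_single v]
    rw [map_sum]
    refine Finset.sum_congr rfl fun i _ => ?_
    rw [show (Pi.single i (v i) : ι → 𝕜) = v i • Pi.single i 1 by simp [← Pi.single_smul], map_smul,
      smul_eq_mul]
  -- The separating functional pulls back to a combination F of the f i with norm at most one, yet
  -- |φ F| > 1.
  let F : StrongDual 𝕜 Z := ∑ i, g (Pi.single i 1) • f i
  have hF : ∀ z, F z = g (J z) := fun z => by
    rw [hgv]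
    simp [F, J, mul_comm]
  have hF1 : ‖F‖ ≤ 1 := by
    refine ContinuousLinearMap.opNorm_le_of_unit_norm (𝕜 := 𝕜) zero_le_one fun z hz => ?_
    rw [hF]
    exact hg _ ⟨z, by simp [hz], rfl⟩
  have hφF : φ F = g fun i => φ (f i) := by
    rw [hgv]
    simp [F, mul_comm]
  rw [← hφF] at hg'
  have := (φ.le_opNorm F).trans (mul_le_one₀ hφ (norm_nonneg _) hF1)
  linarith

/-- Goldstine's theorem, in terms of ultrafilters. -/
lemma exists_ultrafilter_tendsto (φ : StrongDual 𝕜 (StrongDual 𝕜 Z)) (hφ : ‖φ‖ ≤ 1) :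
    ∃ v : Ultrafilter Z, Metric.closedBall (0 : Z) 1 ∈ v ∧
      ∀ f : StrongDual 𝕜 Z, Tendsto (fun z => f z) v (𝓝 (φ f)) := by
  have hmem : (fun f => φ f) ∈
      closure ((fun (z : Z) (f : StrongDual 𝕜 Z) => f z) '' Metric.closedBall (0 : Z) 1) := by
    rw [mem_closure_iff_nhds]
    intro t ht
    rw [nhds_pi, Filter.mem_pi] at ht
    obtain ⟨I, hI, T, hT, hTt⟩ := ht
    have := hI.fintype
    have h := mem_closure_image_closedBall φ hφ fun i : I => (i : StrongDual 𝕜 Z)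
    rw [mem_closure_iff_nhds] at h
    obtain ⟨_, h1, z, hz, rfl⟩ := h (univ.pi fun i : I => T i) (by
      rw [nhds_pi]
      exact Filter.pi_mem_pi finite_univ fun i _ => hT i)
    exact ⟨_, hTt fun i hi => h1 ⟨i, hi⟩ trivial, z, hz, rfl⟩
  obtain ⟨u, hu, hu'⟩ := mem_closure_iff_ultrafilter.1 hmem
  refine ⟨Ultrafilter.ofComapInfPrincipal hu, Ultrafilter.ofComapInfPrincipal_mem hu, fun f => ?_⟩
  have h1 : Tendsto (fun (z : Z) (f : StrongDual 𝕜 Z) => f z) (Ultrafilter.ofComapInfPrincipal hu)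
      (𝓝 fun f => φ f) := by
    rw [Tendsto, ← Ultrafilter.coe_map, Ultrafilter.ofComapInfPrincipal_eq_of_map hu]
    exact hu'
  exact (tendsto_pi_nhds.1 h1) f

set_option maxSynthPendingDepth 3 in
/-- The **Milman–Pettis theorem**. -/
theorem isReflexiveSpace_of_uniformConvexSpace [UniformConvexSpace Z] [CompleteSpace Z] :
    IsReflexiveSpace 𝕜 Z := by
  let : NormedSpace ℝ Z := NormedSpace.restrictScalars ℝ 𝕜 Z
  have key : ∀ φ : StrongDual 𝕜 (StrongDual 𝕜 Z), ‖φ‖ = 1 →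
      ∃ z, NormedSpace.inclusionInDoubleDual 𝕜 Z z = φ := by
    intro φ hφ
    obtain ⟨v, hv, hvf⟩ := exists_ultrafilter_tendsto φ hφ.le
    have hcau : Cauchy (v : Filter Z) := by
      rw [Metric.cauchy_iff]
      refine ⟨v.neBot, fun ε hε => ?_⟩
      -- If f almost norms φ, points x, y of the ball with f x and f y both near φ f satisfy ‖x + y‖
      -- > 2 - δ, so uniform convexity forces them together. Each of the losses sums to at most δ:
      -- 2·δ/4 from f and δ/4 for each point.
      obtain ⟨δ, hδ, hδ'⟩ := exists_forall_closed_ball_dist_add_le_two_sub Z hε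
      obtain ⟨f, hf, hφf⟩ : ∃ f : StrongDual 𝕜 Z, ‖f‖ ≤ 1 ∧ 1 - δ / 4 < ‖φ f‖ := by
        by_contra! h
        have : ‖φ‖ ≤ max 0 (1 - δ / 4) :=
          ContinuousLinearMap.opNorm_le_of_unit_norm (𝕜 := 𝕜) (le_max_left _ _)
            fun f hf => (h f hf.le).trans (le_max_right _ _)
        rw [hφ] at this
        rcases le_max_iff.1 this with h | h <;> linarith
      have hnear := (Metric.tendsto_nhds.1 (hvf f)) (δ / 4) (by positivity)
      refine ⟨_, inter_mem hv hnear, ?_⟩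
      rintro x ⟨hx, hx'⟩ y ⟨hy, hy'⟩
      simp only [mem_closedBall_zero_iff, mem_ofPred_eq, dist_eq_norm] at hx hy hx' hy' ⊢
      by_contra! hxy
      have h1 := hδ' hx hy hxy
      have h2 : ‖f (x + y)‖ ≤ ‖x + y‖ :=
        (f.le_opNorm _).trans (mul_le_of_le_one_left (norm_nonneg _) hf)
      have h3 : 2 * ‖φ f‖ ≤ ‖f (x + y)‖ + ‖f x - φ f‖ + ‖f y - φ f‖ := by
        have : ‖(2 : 𝕜) * φ f‖ = ‖f (x + y) - (f x - φ f) - (f y - φ f)‖ := by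
          congr 1; rw [map_add]; ring
        rw [norm_mul, RCLike.norm_ofNat] at this
        rw [this]
        refine (norm_sub_le _ _).trans ?_
        gcongr
        exact norm_sub_le _ _
      linarith
    obtain ⟨z, hz⟩ := CompleteSpace.complete hcau
    refine ⟨z, ContinuousLinearMap.ext fun f => ?_⟩
    exact tendsto_nhds_unique ((f.continuous.tendsto z).mono_left hz) (hvf f)
  intro φ
  rcases eq_or_ne φ 0 with rfl | h0
  · exact ⟨0, map_zero _⟩
  have hn : ((‖φ‖ : ℝ) : 𝕜) ≠ 0 := by exact_mod_cast norm_ne_zero_iff.2 h0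
  obtain ⟨z, hz⟩ := key (((‖φ‖ : ℝ) : 𝕜)⁻¹ • φ) (by
    rw [norm_smul, norm_inv, RCLike.norm_ofReal, abs_of_nonneg (norm_nonneg _),
      inv_mul_cancel₀ (norm_ne_zero_iff.2 h0)])
  exact ⟨((‖φ‖ : ℝ) : 𝕜) • z, by rw [map_smul, hz, smul_inv_smul₀ hn]⟩

end Reflexivity

/-! ### Clarkson's inequality for scalars and ℓ^p, and uniform convexity. -/

section Clarkson

/-- Clarkson's inequality with exponent `p` for the norm of `F`. -/
def ClarksonIneq (F : Type*) [SeminormedAddCommGroup F] (p : ℝ) : Prop :=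
  ∀ u v : F, ‖u + v‖ ^ p + ‖u - v‖ ^ p ≤ 2 ^ (p - 1) * (‖u‖ ^ p + ‖v‖ ^ p)

lemma ClarksonIneq.uniformConvexSpace {F : Type*} [SeminormedAddCommGroup F] {p : ℝ} (hp : 0 < p)
    (h : ClarksonIneq F p) : UniformConvexSpace F where
  uniform_convex := by
    intro ε hε
    have hεp : 0 < ε ^ p := by positivity
    -- For unit vectors the inequality reads ‖x + y‖^p ≤ 2^p - ‖x - y‖^p. The `max` covers ε > 2,
    -- where 2^p - ε^p is negative.
    refine ⟨2 - (max 0 (2 ^ p - ε ^ p)) ^ p⁻¹, ?_, fun x hx y hy hxy => ?_⟩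
    · rw [sub_pos]
      calc (max 0 ((2 : ℝ) ^ p - ε ^ p)) ^ p⁻¹ < ((2 : ℝ) ^ p) ^ p⁻¹ := by
            refine Real.rpow_lt_rpow (le_max_left _ _) ?_ (by positivity)
            exact max_lt (by positivity) (by linarith)
        _ = 2 := Real.rpow_rpow_inv (by norm_num) hp.ne'
    · have h1 := h x y
      rw [hx, hy, Real.one_rpow, Real.rpow_sub_one (by norm_num)] at h1
      have h2 : ε ^ p ≤ ‖x - y‖ ^ p := by gcongr
      have h3 : ‖x + y‖ ^ p ≤ max 0 (2 ^ p - ε ^ p) := le_max_of_le_right (by linarith)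
      have h4 : (‖x + y‖ ^ p) ^ p⁻¹ ≤ (max 0 (2 ^ p - ε ^ p)) ^ p⁻¹ := by gcongr
      rw [Real.rpow_rpow_inv (norm_nonneg _) hp.ne'] at h4
      linarith

/-- The parallelogram law is the case p = 2. The function s ↦ s^(p/2) is superadditive, which
handles the left side, and convex, which handles the right side; both use p ≥ 2. -/
lemma clarksonIneq_rclike {𝕜 : Type*} [RCLike 𝕜] {p : ℝ} (hp : 2 ≤ p) : ClarksonIneq 𝕜 p := by
  intro a b
  have hpar : ‖a + b‖ ^ 2 + ‖a - b‖ ^ 2 = 2 * (‖a‖ ^ 2 + ‖b‖ ^ 2) := by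
    have := parallelogram_law_with_norm 𝕜 a b
    nlinarith
  have e : ∀ x : ℝ, 0 ≤ x → x ^ p = (x ^ 2) ^ (p / 2) := fun x hx => by
    rw [← Real.rpow_natCast, ← Real.rpow_mul hx]; congr 1; push_cast; ring
  have hp2 : 1 ≤ p / 2 := by linarith
  rw [e _ (norm_nonneg (a + b)), e _ (norm_nonneg (a - b))]
  calc (‖a + b‖ ^ 2) ^ (p / 2) + (‖a - b‖ ^ 2) ^ (p / 2)
      ≤ (‖a + b‖ ^ 2 + ‖a - b‖ ^ 2) ^ (p / 2) :=
        Real.add_rpow_le_rpow_add (by positivity) (by positivity) hp2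
    _ = 2 ^ (p / 2) * (‖a‖ ^ 2 + ‖b‖ ^ 2) ^ (p / 2) := by
        rw [hpar, Real.mul_rpow (by norm_num) (by positivity)]
    _ ≤ 2 ^ (p / 2) * (2 ^ (p / 2 - 1) * ((‖a‖ ^ 2) ^ (p / 2) + (‖b‖ ^ 2) ^ (p / 2))) := by
        gcongr
        have h := NNReal.rpow_add_le_mul_rpow_add_rpow (‖a‖₊ ^ (2 : ℕ)) (‖b‖₊ ^ (2 : ℕ)) hp2
        exact_mod_cast h
    _ = 2 ^ (p - 1) * (‖a‖ ^ p + ‖b‖ ^ p) := by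
        rw [← mul_assoc, ← Real.rpow_add (by norm_num), e _ (norm_nonneg a), e _ (norm_nonneg b)]
        congr 2; ring

lemma clarksonIneq_lp {𝕜 : Type*} [RCLike 𝕜] {p : ℝ} [hp : Fact (2 < p)] :
    ClarksonIneq (lp (fun _ : ℕ => 𝕜) (ENNReal.ofReal p)) p := by
  have hp0 : 0 < p := by linarith [hp.out]
  have hr : (ENNReal.ofReal p).toReal = p := ENNReal.toReal_ofReal hp0.le
  have hs : ∀ f : lp (fun _ : ℕ => 𝕜) (ENNReal.ofReal p), HasSum (fun i => ‖f i‖ ^ p) (‖f‖ ^ p) :=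
    fun f => by simpa only [hr] using lp.hasSum_norm (by rw [hr]; exact hp0) f
  intro u v
  refine hasSum_le (fun i => ?_) ((hs (u + v)).add (hs (u - v)))
    (((hs u).add (hs v)).mul_left (2 ^ (p - 1)))
  exact clarksonIneq_rclike hp.out.le (u i) (v i)

end Clarkson

/-! ### Compact sets, null sequences and the existence of admissible pairs. -/

section NullSequences

/-- The disjoint union of the D m is enumerated together with a copy of ℕ sent to 0. The copy makes
the index set infinite, hence denumerable, and puts 0 into the range. -/
lemma exists_seq_tendsto_zero_of_finite {F : Type*} [NormedAddCommGroup F] (D : ℕ → Set F)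
    (hD : ∀ m, (D m).Finite) (c : ℕ → ℝ) (hc : Tendsto c atTop (𝓝 0))
    (hDc : ∀ m, ∀ d ∈ D m, ‖d‖ ≤ c m) :
    ∃ x : ℕ → F, Tendsto x atTop (𝓝 0) ∧ 0 ∈ range x ∧ ∀ m, D m ⊆ range x := by
  have := fun m => (hD m).fintype
  let ι := ℕ ⊕ Σ m, D m
  obtain ⟨_⟩ := nonempty_denumerable ι
  let y : ι → F := Sum.elim (fun _ => 0) fun i => i.2
  have hy : Tendsto y cofinite (𝓝 0) := by
    rw [Metric.tendsto_nhds]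
    intro ε hε
    obtain ⟨M, hM⟩ := eventually_atTop.1 (hc.eventually_lt_const hε)
    rw [eventually_cofinite]
    have hfin : (⋃ m ∈ Iio M, range fun d : D m => (Sum.inr ⟨m, d⟩ : ι)).Finite :=
      (finite_Iio M).biUnion fun m _ => finite_range _
    refine hfin.subset ?_
    rintro (n | ⟨m, d⟩) h
    · exact absurd (by simpa [y] using hε) h
    · simp only [mem_iUnion]
      refine ⟨m, ?_, d, rfl⟩
      by_contra hm
      apply h
      rw [dist_zero_right]
      exact (hDc m d d.2).trans_lt (hM m (not_lt.1 hm))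
  let e := (Denumerable.eqv ι).symm
  refine ⟨y ∘ e, ?_, ⟨e.symm (Sum.inl 0), by simp [y]⟩, fun m d hd =>
    ⟨e.symm (Sum.inr ⟨m, d, hd⟩), by simp [y]⟩⟩
  rw [← Nat.cofinite_eq_atTop]
  exact hy.comp e.injective.tendsto_cofinite

/-- Grothendieck: a compact set lies in the closed convex hull of a null sequence. -/
lemma exists_seq_subset_closure_convexHull {F : Type*} [NormedAddCommGroup F] [NormedSpace ℝ F]
    {K : Set F} (hK : IsCompact K) :
    ∃ x : ℕ → F, Tendsto x atTop (𝓝 0) ∧ K ⊆ closure (convexHull ℝ (range x)) := by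
  have hnet : ∀ m : ℕ, ∃ t ⊆ K, t.Finite ∧ K ⊆ ⋃ a ∈ t, Metric.ball a ((1 / 4 : ℝ) ^ m) :=
    fun m => by
      obtain ⟨t, ht⟩ := hK.elim_finite_subcover_image (b := K)
        (c := fun a => Metric.ball a ((1 / 4 : ℝ) ^ m)) (fun a _ => Metric.isOpen_ball)
        (fun a ha => mem_biUnion ha (Metric.mem_ball_self (by positivity)))
      exact ⟨t, ht.1, ht.2.1, ht.2.2⟩
  choose A hAK hAf hAc using hnet
  -- A point of K is f 0 + ∑ (f (m+1) - f m) with f m in the net A m. The first term gets weight 1/2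
  -- and the m-th difference weight 2^(-(m+2)), so the vectors to enumerate are the terms divided by
  -- their weights. Intersecting with the bound 8·2^(-m) = 2^(m+2)·2·4^(-m) discards pairs of net
  -- points that are not close.
  let D : ℕ → Set F := fun m => Nat.casesOn m ((fun a => (2 : ℝ) • a) '' A 0) fun m =>
    ((fun q : F × F => (2 : ℝ) ^ (m + 2) • (q.1 - q.2)) '' (A (m + 1) ×ˢ A m)) ∩
      {d | ‖d‖ ≤ 8 * (1 / 2) ^ m}
  obtain ⟨R, hR⟩ := (hAf 0).isBounded.exists_norm_le
  obtain ⟨x, hx, hx0, hxD⟩ := exists_seq_tendsto_zero_of_finite D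
    (fun m => by
      cases m with
      | zero => exact (hAf 0).image _
      | succ m => exact (((hAf _).prod (hAf _)).image _).subset inter_subset_left)
    (fun m => Nat.casesOn m (2 * R) fun m => 8 * (1 / 2) ^ m)
    (by
      rw [← tendsto_add_atTop_iff_nat 1]
      simpa using (tendsto_pow_atTop_nhds_zero_of_lt_one (by norm_num : (0 : ℝ) ≤ 1 / 2)
        (by norm_num)).const_mul 8)
    (fun m d hd => by
      cases m with
      | zero =>
        obtain ⟨a, ha, rfl⟩ := hd
        simp only [norm_smul, Real.norm_ofNat]
        exact mul_le_mul_of_nonneg_left (hR a ha) (by norm_num)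
      | succ m => exact hd.2)
  refine ⟨x, hx, fun k hk => ?_⟩
  have hfx : ∀ m, ∃ a ∈ A m, dist k a < (1 / 4 : ℝ) ^ m := fun m => by
    simpa using hAc m hk
  choose f hfA hfk using hfx
  set C := convexHull ℝ (range x)
  have hC : Convex ℝ C := convex_convexHull ℝ _
  have hC0 : (0 : F) ∈ C := subset_convexHull ℝ _ hx0
  -- The weights used up to stage m add up to 1 - 2^(-(m+1)).
  have hsum : ∀ m, ∃ q ∈ C, f m = (1 - (1 / 2 : ℝ) ^ (m + 1)) • q := by
    intro m
    induction m with
    | zero =>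
      refine ⟨(2 : ℝ) • f 0, subset_convexHull ℝ _ (hxD 0 ⟨f 0, hfA 0, rfl⟩), ?_⟩
      rw [smul_smul]; norm_num
    | succ m ih =>
      obtain ⟨q, hq, hfq⟩ := ih
      set d := (2 : ℝ) ^ (m + 2) • (f (m + 1) - f m) with hd
      have hdC : d ∈ C := by
        refine subset_convexHull ℝ _ (hxD (m + 1) ⟨⟨(f (m + 1), f m), ⟨hfA _, hfA _⟩, rfl⟩, ?_⟩)
        change ‖d‖ ≤ _
        rw [hd, norm_smul, Real.norm_of_nonneg (by positivity)]
        have h1 : ‖f (m + 1) - f m‖ ≤ 2 * (1 / 4) ^ m := by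
          rw [← dist_eq_norm]
          have h3 : (1 / 4 : ℝ) ^ (m + 1) ≤ (1 / 4) ^ m :=
            pow_le_pow_of_le_one (by norm_num) (by norm_num) (by omega)
          have := dist_triangle_left (f (m + 1)) (f m) k
          linarith [hfk m, hfk (m + 1)]
        calc (2 : ℝ) ^ (m + 2) * ‖f (m + 1) - f m‖ ≤ 2 ^ (m + 2) * (2 * (1 / 4) ^ m) := by gcongr
          _ = 8 * (1 / 2) ^ m := by
            rw [show (1 / 4 : ℝ) = 1 / 2 * (1 / 2) by norm_num, mul_pow, pow_add]
            have : (2 : ℝ) ^ m * (1 / 2) ^ m = 1 := by rw [← mul_pow]; norm_num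
            linear_combination (8 * (1 / 2) ^ m) * this
      have hlt : 0 < 1 - (1 / 2 : ℝ) ^ (m + 1 + 1) :=
        sub_pos.2 (pow_lt_one₀ (by norm_num) (by norm_num) (by omega))
      have hle : 0 ≤ 1 - (1 / 2 : ℝ) ^ (m + 1) :=
        sub_nonneg.2 (pow_le_one₀ (by norm_num) (by norm_num))
      refine ⟨_, hC hq hdC (div_nonneg hle hlt.le)
        (b := (1 / 2 : ℝ) ^ (m + 1 + 1) / (1 - (1 / 2 : ℝ) ^ (m + 1 + 1))) (by positivity) ?_, ?_⟩
      · rw [← add_div, div_eq_one_iff_eq hlt.ne']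
        ring
      · rw [smul_add, smul_smul, smul_smul, mul_div_cancel₀ _ hlt.ne', mul_div_cancel₀ _ hlt.ne',
          ← hfq, hd, smul_smul, ← mul_pow]
        norm_num
  have hf : Tendsto f atTop (𝓝 k) := by
    rw [tendsto_iff_dist_tendsto_zero]
    refine squeeze_zero (fun _ => dist_nonneg) (fun m => ?_)
      (tendsto_pow_atTop_nhds_zero_of_lt_one (by norm_num : (0 : ℝ) ≤ 1 / 4) (by norm_num))
    rw [dist_comm]; exact (hfk m).le
  refine mem_closure_of_tendsto hf (Eventually.of_forall fun m => ?_)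
  obtain ⟨q, hq, h⟩ := hsum m
  rw [h]
  have h2 : (1 / 2 : ℝ) ^ (m + 1) ≤ 1 := pow_le_one₀ (by norm_num) (by norm_num)
  exact hC.smul_mem_of_zero_mem hC0 hq ⟨by linarith, by linarith [show (0 : ℝ) ≤ (1 / 2) ^ (m + 1) by positivity]⟩

lemma exists_antitone_bound {u : ℕ → ℝ} (hu0 : ∀ n, 0 ≤ u n) (hu : Tendsto u atTop (𝓝 0)) :
    ∃ b : ℕ → ℝ, Antitone b ∧ Tendsto b atTop (𝓝 0) ∧ ∀ n, u n ≤ b n := by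
  have hb : ∀ n, BddAbove (range fun m => u (n + m)) := fun n =>
    hu.bddAbove_range.mono (range_subset_iff.2 fun m => mem_range_self _)
  have hle : ∀ n, u n ≤ ⨆ m, u (n + m) := fun n => le_ciSup (hb n) 0
  refine ⟨fun n => ⨆ m, u (n + m), fun n k hnk => ciSup_le fun m => ?_, ?_, hle⟩
  · have := le_ciSup (hb n) (k - n + m)
    rwa [show n + (k - n + m) = k + m by omega] at this
  · rw [Metric.tendsto_atTop]
    intro ε hε
    obtain ⟨M, hM⟩ := eventually_atTop.1 (hu.eventually_lt_const (half_pos hε))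
    refine ⟨M, fun n hn => ?_⟩
    rw [Real.dist_0_eq_abs, abs_of_nonneg ((hu0 n).trans (hle n))]
    exact (ciSup_le fun m => (hM (n + m) (by omega)).le).trans_lt (half_lt_self hε)

variable {𝕜 : Type*} [RCLike 𝕜] {E : Type*} [NormedAddCommGroup E] [NormedSpace 𝕜 E]
  [NormedSpace ℝ E] [IsScalarTower ℝ 𝕜 E]

/-- A space without the approximation property carries an admissible pair. -/
theorem exists_isAdmissible (hAP : ¬ HasAP 𝕜 E) :
    ∃ (x : ℕ → E) (N : ℕ → ℕ), IsAdmissible 𝕜 x N := by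
  simp only [HasAP, not_forall] at hAP
  obtain ⟨K, hK, hKA⟩ := hAP
  obtain ⟨x, hx, hKx⟩ := exists_seq_subset_closure_convexHull hK
  have hex : ∃ e : E, ‖e‖ = 1 := by
    by_contra! h
    refine hKA fun ε hε => ⟨0, ?_, fun z _ => ?_⟩
    · rw [ContinuousLinearMap.toLinearMap_zero, LinearMap.range_zero]; infer_instance
    · have hz : z = 0 := by
        by_contra hz
        exact h ((‖z‖⁻¹ : ℝ) • z) (by
          rw [norm_smul, norm_inv, norm_norm, inv_mul_cancel₀ (norm_ne_zero_iff.2 hz)])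
      simpa [hz] using hε
  obtain ⟨e, he⟩ := hex
  obtain ⟨b, hb, hb0, hxb⟩ := exists_antitone_bound (fun n => norm_nonneg (x n))
    (by simpa using hx.norm)
  have hb_nonneg : ∀ n, 0 ≤ b n := fun n => (norm_nonneg _).trans (hxb n)
  -- Scaling by c brings the whole sequence into the unit ball; the summand 1 avoids division by
  -- zero.
  set c : ℝ := (b 0 + 1)⁻¹ with hc
  have hc0 : 0 < c := inv_pos.2 (by linarith [hb_nonneg 0])
  -- Each c • x n is stretched to the prescribed decreasing norm c * b n, a unit vector e serving as
  -- direction when x n = 0. Since 0 lies in the closed hull of the y n, this hull still contains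
  -- every c • x n.
  have hy : ∀ n, ∃ y : E, ‖y‖ = c * b n ∧ ∃ θ ∈ Icc (0 : ℝ) 1, c • x n = θ • y := by
    intro n
    rcases eq_or_ne (x n) 0 with h | h
    · refine ⟨(c * b n) • e, ?_, 0, by simp, by simp [h]⟩
      rw [norm_smul, he, mul_one, Real.norm_of_nonneg (mul_nonneg hc0.le (hb_nonneg n))]
    · have hxn : 0 < ‖x n‖ := norm_pos_iff.2 h
      have hbn : 0 < b n := hxn.trans_le (hxb n)
      refine ⟨(c * b n / ‖x n‖) • x n, ?_, ‖x n‖ / b n, ⟨by positivity, ?_⟩, ?_⟩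
      · rw [norm_smul, Real.norm_of_nonneg (by positivity), div_mul_cancel₀ _ hxn.ne']
      · exact (div_le_one hbn).2 (hxb n)
      · rw [smul_smul]; congr 1; field_simp
  choose y hyn θ hθ hxy using hy
  have hy0 : Tendsto (fun n => ‖y n‖) atTop (𝓝 0) := by
    simp only [hyn]; simpa using hb0.const_mul c
  obtain ⟨N, hN, hN'⟩ := extraction_forall_of_eventually
    (P := fun k M => ∀ n, M ≤ n → ‖y n‖ < (1 / 2 : ℝ) ^ (k + 1)) (fun k => by
      obtain ⟨M, hM⟩ := eventually_atTop.1
        (hy0.eventually_lt_const (show (0 : ℝ) < (1 / 2) ^ (k + 1) by positivity))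
      exact eventually_atTop.2 ⟨M, fun M' hM' n hn => hM n (hM'.trans hn)⟩)
  refine ⟨y, N, ⟨fun n => ?_, fun m n hmn => ?_, hy0, fun hA => hKA fun ε hε => ?_, hN, hN'⟩⟩
  · rw [hyn, hc, inv_mul_le_iff₀ (by linarith [hb_nonneg 0])]
    linarith [hb (Nat.zero_le n)]
  · simp only [hyn]
    exact mul_le_mul_of_nonneg_left (hb hmn) hc0.le
  · obtain ⟨T, hT, hTK⟩ := hA (c * ε) (by positivity)
    refine ⟨T, hT, fun z hz => ?_⟩
    set C := closure (convexHull ℝ (range y))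
    have hC : Convex ℝ C := (convex_convexHull ℝ _).closure
    have hyC : ∀ n, y n ∈ C := fun n => subset_closure (subset_convexHull ℝ _ (mem_range_self n))
    have h0C : (0 : E) ∈ C := isClosed_closure.mem_of_tendsto
      (tendsto_zero_iff_norm_tendsto_zero.2 hy0) (Eventually.of_forall hyC)
    have hcC : closure (convexHull ℝ (range x)) ⊆ (c • ·) ⁻¹' C := by
      refine closure_minimal (convexHull_min ?_ ?_)
        (isClosed_closure.preimage (continuous_const_smul c))
      · rintro _ ⟨n, rfl⟩
        change c • x n ∈ C
        rw [hxy]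
        exact hC.smul_mem_of_zero_mem h0C (hyC n) (hθ n)
      · exact hC.smul_preimage c
    have h := hTK _ (hcC (hKx hz))
    have hTc : T (c • z) = c • T z := by
      rw [← algebraMap_smul 𝕜 c z, map_smul, algebraMap_smul]
    rw [hTc, ← smul_sub, norm_smul, Real.norm_of_nonneg hc0.le] at h
    exact lt_of_mul_lt_mul_left h hc0.le

end NullSequences

/-! ### The norm of W_t through decompositions. -/

section NormW

/-- The radius of the ball of `X_k` that enters `V_t`. -/
def radiusV (t : ℝ) (k : ℕ) : ℝ := ((1 / 2 : ℝ) ^ k) ^ (1 - t)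

lemma radiusV_pos (t : ℝ) (k : ℕ) : 0 < radiusV t k := by unfold radiusV; positivity

lemma radiusV_eq_pow (t : ℝ) (k : ℕ) : radiusV t k = ((1 / 2 : ℝ) ^ (1 - t)) ^ k := by
  rw [radiusV, ← Real.rpow_natCast, ← Real.rpow_natCast, ← Real.rpow_mul (by norm_num),
    ← Real.rpow_mul (by norm_num), mul_comm]

lemma half_rpow_lt_one {s : ℝ} (hs : 0 < s) : (1 / 2 : ℝ) ^ s < 1 :=
  Real.rpow_lt_one (by norm_num) (by norm_num) hs

lemma tsum_radiusV_nonneg (t : ℝ) : 0 ≤ ∑' k, radiusV t k :=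
  tsum_nonneg fun k => (radiusV_pos t k).le

lemma summable_radiusV {t : ℝ} (ht : t < 1) : Summable (radiusV t) := by
  simp only [funext (radiusV_eq_pow t)]
  exact summable_geometric_of_lt_one (by positivity) (half_rpow_lt_one (by linarith))

variable {𝕜 : Type*} [RCLike 𝕜] {E : Type*} [NormedAddCommGroup E] [NormedSpace 𝕜 E]
  [NormedSpace ℝ E] [IsScalarTower ℝ 𝕜 E] {X : ℕ → Submodule 𝕜 E} {p s t : ℝ}

lemma spaceW_smul_mem (c : ℝ) {w : E} (hw : w ∈ spaceW X p t) : c • w ∈ spaceW X p t := by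
  rw [← algebraMap_smul 𝕜 c w]
  exact Submodule.smul_mem _ _ hw

lemma normW_zero : normW X p t 0 = 0 := gauge_zero

lemma normW_real_smul (hp : 1 ≤ p) (c : ℝ) (w : E) :
    normW X p t (c • w) = |c| * normW X p t w := by
  rw [← algebraMap_smul 𝕜 c w, normW_smul hp, RCLike.algebraMap_eq_ofReal, RCLike.norm_ofReal]

lemma normW_sub_le (hp : 1 ≤ p) (ht0 : 0 < t) (ht1 : t < 1) {v w : E}
    (hv : v ∈ spaceW X p t) (hw : w ∈ spaceW X p t) :
    normW X p t (v - w) ≤ normW X p t v + normW X p t w := by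
  have h := normW_add_le hp ht0 ht1 hv (spaceW_smul_mem (-1) hw)
  rwa [normW_real_smul hp, abs_neg, abs_one, one_mul, neg_one_smul, ← sub_eq_add_neg] at h

/-- Each block is normalised to the extreme radius: b_k is C times a vector of norm ρ_k(t) times the
coefficient ‖b_k‖ / (C ρ_k(t)). The condition on coefficients in V_t becomes the weighted ℓ^p bound.
-/
lemma mem_smul_setV_of_hasSum (hp : 1 ≤ p) (ht1 : t < 1) {w : E} {b : ℕ → E}
    (hb : ∀ k, b k ∈ X k) (hw : HasSum b w) (hs : Summable fun k => (‖b k‖ / radiusV t k) ^ p)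
    {C : ℝ} (hC : 0 < C) (hbC : ∑' k, (‖b k‖ / radiusV t k) ^ p ≤ C ^ p) :
    w ∈ C • setV X p t := by
  have hp0 : 0 < p := by linarith
  rw [mem_smul_set_iff_inv_smul_mem₀ hC.ne', mem_setV_iff ht1]
  set γ : ℕ → ℝ := fun k => ‖b k‖ / radiusV t k / C with hγ
  have hγ0 : ∀ k, 0 ≤ γ k := fun k => by have := radiusV_pos t k; positivity
  have hn : ∀ k, ‖((γ k : ℝ) : 𝕜)‖ = γ k := fun k => by
    rw [RCLike.norm_ofReal, abs_of_nonneg (hγ0 k)]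
  have hγp : ∀ k, γ k ^ p = (C ^ p)⁻¹ * (‖b k‖ / radiusV t k) ^ p := fun k => by
    rw [hγ, Real.div_rpow (by have := radiusV_pos t k; positivity) hC.le, div_eq_inv_mul]
  have hbγ : ∀ k, b k ≠ 0 → γ k ≠ 0 := fun k hk => by
    have := radiusV_pos t k
    have := norm_pos_iff.2 hk
    positivity
  refine ⟨fun k => (γ k : 𝕜), fun k => ((γ k : ℝ) : 𝕜)⁻¹ • C⁻¹ • b k, fun k => ⟨?_, ?_⟩, ?_, ?_, ?_⟩
  · refine (X k).smul_mem _ ?_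
    rw [← algebraMap_smul 𝕜 C⁻¹]
    exact (X k).smul_mem _ (hb k)
  · change _ ≤ radiusV t k
    have hr := radiusV_pos t k
    rcases eq_or_ne (b k) 0 with h | h
    · simp [h, hr.le]
    · have := norm_pos_iff.2 h
      rw [norm_smul, norm_inv, hn, norm_smul, Real.norm_of_nonneg (inv_pos.2 hC).le]
      apply le_of_eq
      simp only [hγ]
      field_simp
  · simpa only [hn, hγp] using hs.mul_left _
  · simp only [hn, hγp]
    rw [tsum_mul_left, inv_mul_le_iff₀ (by positivity), mul_one]
    exact hbC
  · refine (hw.const_smul C⁻¹).congr_fun fun k => ?_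
    rcases eq_or_ne (b k) 0 with h | h
    · simp [h]
    · have h' : ((γ k : ℝ) : 𝕜) ≠ 0 := by exact_mod_cast hbγ k h
      exact smul_inv_smul₀ h' _

lemma mem_spaceW_of_mem_smul {C : ℝ} {w : E} (h : w ∈ C • setV X p t) : w ∈ spaceW X p t := by
  obtain ⟨v, hv, rfl⟩ := h
  exact spaceW_smul_mem C (Submodule.subset_span hv)

lemma mem_spaceW_of_hasSum (hp : 1 ≤ p) (ht1 : t < 1) {w : E} {b : ℕ → E}
    (hb : ∀ k, b k ∈ X k) (hw : HasSum b w)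
    (hs : Summable fun k => (‖b k‖ / radiusV t k) ^ p) : w ∈ spaceW X p t := by
  have h0 : 0 ≤ ∑' k, (‖b k‖ / radiusV t k) ^ p :=
    tsum_nonneg fun k => by have := radiusV_pos t k; positivity
  refine mem_spaceW_of_mem_smul (mem_smul_setV_of_hasSum hp ht1 hb hw hs
    (C := (∑' k, (‖b k‖ / radiusV t k) ^ p + 1) ^ p⁻¹) (by positivity) ?_)
  rw [Real.rpow_inv_rpow (by positivity) (by linarith)]
  linarith

lemma normW_rpow_le_tsum (hp : 1 ≤ p) (ht1 : t < 1) {w : E} {b : ℕ → E}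
    (hb : ∀ k, b k ∈ X k) (hw : HasSum b w)
    (hs : Summable fun k => (‖b k‖ / radiusV t k) ^ p) :
    normW X p t w ^ p ≤ ∑' k, (‖b k‖ / radiusV t k) ^ p := by
  have hp0 : 0 < p := by linarith
  have h0 : 0 ≤ ∑' k, (‖b k‖ / radiusV t k) ^ p :=
    tsum_nonneg fun k => by have := radiusV_pos t k; positivity
  rw [← Real.le_rpow_inv_iff_of_pos (normW_nonneg w) h0 hp0]
  refine le_of_forall_gt_imp_ge_of_dense fun C hC => ?_
  have hC0 : 0 < C := (Real.rpow_nonneg h0 _).trans_lt hC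
  refine gauge_le_of_mem hC0.le (mem_smul_setV_of_hasSum hp ht1 hb hw hs hC0 ?_)
  rw [← Real.rpow_inv_le_iff_of_pos h0 hC0.le hp0]
  exact hC.le

lemma exists_hasSum_of_normW_lt (hp : 1 ≤ p) (ht0 : 0 < t) (ht1 : t < 1) {w : E}
    (hw : w ∈ spaceW X p t) {C : ℝ} (hC : normW X p t w < C) :
    ∃ b : ℕ → E, (∀ k, b k ∈ X k) ∧ HasSum b w ∧
      Summable (fun k => (‖b k‖ / radiusV t k) ^ p) ∧
      ∑' k, (‖b k‖ / radiusV t k) ^ p ≤ C ^ p := by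
  have hp0 : 0 < p := by linarith
  obtain ⟨r, ⟨hr, hwr⟩, hrC⟩ := exists_lt_of_csInf_lt (exists_mem_smul_setV hp ht0 ht1 hw) hC
  have hr' : 0 < r := hr
  obtain ⟨v, hv, rfl⟩ := hwr
  obtain ⟨α, b, h1, h2, h3, h4⟩ := (mem_setV_iff ht1 v).1 hv
  have hle : ∀ k, (‖r • α k • b k‖ / radiusV t k) ^ p ≤ r ^ p * ‖α k‖ ^ p := fun k => by
    have hrad := radiusV_pos t k
    rw [← Real.mul_rpow hr'.le (norm_nonneg _), norm_smul, norm_smul, Real.norm_of_nonneg hr'.le]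
    refine Real.rpow_le_rpow (by positivity) ?_ hp0.le
    rw [div_le_iff₀ hrad, mul_assoc]
    gcongr
    exact (h1 k).2
  have hsum : Summable fun k => (‖r • α k • b k‖ / radiusV t k) ^ p :=
    Summable.of_nonneg_of_le (fun k => by have := radiusV_pos t k; positivity) hle (h2.mul_left _)
  refine ⟨fun k => r • α k • b k, fun k => ?_, h4.const_smul r, hsum, ?_⟩
  · change r • α k • b k ∈ X k
    rw [← algebraMap_smul 𝕜 r]
    exact (X k).smul_mem _ ((X k).smul_mem _ (h1 k).1)
  · refine (hsum.tsum_le_tsum hle (h2.mul_left _)).trans ?_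
    rw [tsum_mul_left]
    calc r ^ p * ∑' k, ‖α k‖ ^ p ≤ r ^ p * 1 := by gcongr
      _ ≤ C ^ p := by rw [mul_one]; gcongr

lemma norm_le_of_tsum_le (hp : 1 ≤ p) {b : ℕ → E}
    (hs : Summable fun k => (‖b k‖ / radiusV t k) ^ p) {C : ℝ} (hC : 0 ≤ C)
    (hbC : ∑' k, (‖b k‖ / radiusV t k) ^ p ≤ C ^ p) (k : ℕ) : ‖b k‖ ≤ C * radiusV t k := by
  have hr := radiusV_pos t k
  have h : (‖b k‖ / radiusV t k) ^ p ≤ C ^ p :=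
    (hs.le_tsum k fun j _ => by have := radiusV_pos t j; positivity).trans hbC
  rw [Real.rpow_le_rpow_iff (by positivity) hC (by linarith), div_le_iff₀ hr] at h
  exact h

/-- The inclusion of `W_t` in the ambient space is continuous. -/
lemma norm_le_mul_normW (hp : 1 ≤ p) (ht0 : 0 < t) (ht1 : t < 1) {w : E}
    (hw : w ∈ spaceW X p t) : ‖w‖ ≤ (∑' k, radiusV t k) * normW X p t w := by
  have key : ∀ C, normW X p t w < C → ‖w‖ ≤ (∑' k, radiusV t k) * C := fun C hC => by
    obtain ⟨b, -, h2, h3, h4⟩ := exists_hasSum_of_normW_lt hp ht0 ht1 hw hC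
    rw [← h2.tsum_eq, mul_comm]
    exact tsum_of_norm_bounded ((summable_radiusV ht1).hasSum.mul_left C)
      (norm_le_of_tsum_le hp h3 ((normW_nonneg w).trans hC.le) h4)
  refine ge_of_tendsto (x := 𝓝[>] (normW X p t w)) (f := fun C => (∑' k, radiusV t k) * C) ?_
    (eventually_nhdsWithin_of_forall key)
  exact (continuous_const.mul continuous_id).continuousWithinAt

/-- Clarkson's inequality passes to the spaces `W_t`. -/
lemma normW_clarkson (hp : 1 ≤ p) (hE : ClarksonIneq E p) (ht0 : 0 < t) (ht1 : t < 1) {u v : E}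
    (hu : u ∈ spaceW X p t) (hv : v ∈ spaceW X p t) :
    normW X p t (u + v) ^ p + normW X p t (u - v) ^ p ≤
      2 ^ (p - 1) * (normW X p t u ^ p + normW X p t v ^ p) := by
  have hp0 : 0 < p := by linarith
  -- The infimum over decompositions need not be attained. Decompositions b, c optimal up to δ give
  -- decompositions b ± c of u ± v, to which Clarkson's inequality in E applies block by block.
  have key : ∀ δ > 0, normW X p t (u + v) ^ p + normW X p t (u - v) ^ p ≤
      2 ^ (p - 1) * ((normW X p t u + δ) ^ p + (normW X p t v + δ) ^ p) := by
    intro δ hδ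
    obtain ⟨b, b1, b2, b3, b4⟩ :=
      exists_hasSum_of_normW_lt hp ht0 ht1 hu (lt_add_of_pos_right _ hδ)
    obtain ⟨c, c1, c2, c3, c4⟩ :=
      exists_hasSum_of_normW_lt hp ht0 ht1 hv (lt_add_of_pos_right _ hδ)
    set D : (ℕ → E) → ℕ → ℝ := fun b k => (‖b k‖ / radiusV t k) ^ p with hD
    have hD0 : ∀ b k, 0 ≤ D b k := fun b k => by
      have := radiusV_pos t k
      simp only [hD]; positivity
    have hk : ∀ k, D (b + c) k + D (b - c) k ≤ 2 ^ (p - 1) * (D b k + D c k) := fun k => by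
      have hr := radiusV_pos t k
      simp only [hD, Real.div_rpow (norm_nonneg _) hr.le, ← add_div, ← mul_div_assoc]
      gcongr
      exact hE (b k) (c k)
    have hS : Summable fun k => 2 ^ (p - 1) * (D b k + D c k) := (b3.add c3).mul_left _
    have h1 : Summable (D (b + c)) := Summable.of_nonneg_of_le (hD0 _)
      (fun k => (le_add_of_nonneg_right (hD0 _ k)).trans (hk k)) hS
    have h2 : Summable (D (b - c)) := Summable.of_nonneg_of_le (hD0 _)
      (fun k => (le_add_of_nonneg_left (hD0 _ k)).trans (hk k)) hS
    calc normW X p t (u + v) ^ p + normW X p t (u - v) ^ p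
        ≤ ∑' k, D (b + c) k + ∑' k, D (b - c) k := add_le_add
          (normW_rpow_le_tsum hp ht1 (fun k => (X k).add_mem (b1 k) (c1 k)) (b2.add c2) h1)
          (normW_rpow_le_tsum hp ht1 (fun k => (X k).sub_mem (b1 k) (c1 k)) (b2.sub c2) h2)
      _ = ∑' k, (D (b + c) k + D (b - c) k) := (h1.tsum_add h2).symm
      _ ≤ ∑' k, 2 ^ (p - 1) * (D b k + D c k) := (h1.add h2).tsum_le_tsum hk hS
      _ = 2 ^ (p - 1) * (∑' k, D b k + ∑' k, D c k) := by
          rw [tsum_mul_left, Summable.tsum_add b3 c3]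
      _ ≤ _ := by gcongr
  refine ge_of_tendsto (x := 𝓝[>] (0 : ℝ)) ?_ (eventually_nhdsWithin_of_forall key)
  have : ContinuousAt (fun δ => 2 ^ (p - 1) * ((normW X p t u + δ) ^ p +
      (normW X p t v + δ) ^ p)) 0 := by
    refine ContinuousAt.mul continuousAt_const (ContinuousAt.add ?_ ?_) <;>
    exact ContinuousAt.rpow_const (by fun_prop) (Or.inr hp0.le)
  simpa using this.tendsto.mono_left nhdsWithin_le_nhds

end NormW

/-! ### Step functions, Clarkson's inequality in the function space, and reflexivity. -/

section PreZ

variable {𝕜 : Type*} [RCLike 𝕜] {E : Type*} [NormedAddCommGroup E] [NormedSpace 𝕜 E]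
  [NormedSpace ℝ E] [IsScalarTower ℝ 𝕜 E] {X : ℕ → Submodule 𝕜 E} {p s t : ℝ}

lemma PreZ.toFun_mem_spaceW (hp : 1 ≤ p) (f : PreZ X p) {r : ℝ} (hr : r ∈ Ioo (0 : ℝ) 1) :
    f.toFun r ∈ spaceW X p r := (stepFunctions_props hp f.toFun_mem).2.1 r hr

lemma PreZ.toFun_sum {ι : Type*} (I : Finset ι) (f : ι → PreZ X p) (r : ℝ) :
    (∑ i ∈ I, f i).toFun r = ∑ i ∈ I, (f i).toFun r := by
  classical
  induction I using Finset.induction_on with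
  | empty => rfl
  | insert a I ha ih => rw [Finset.sum_insert ha, Finset.sum_insert ha, PreZ.toFun_add, ih]

lemma PreZ.toFun_sub (f g : PreZ X p) (r : ℝ) : (f - g).toFun r = f.toFun r - g.toFun r := rfl

lemma PreZ.integrable (hp : 1 ≤ p) (f : PreZ X p) :
    Integrable (fun r => normW X p r (f.toFun r) ^ p) (volume.restrict (Ioo (0 : ℝ) 1)) := by
  have h := (PreZ.memLp hp f).integrable_norm_rpow (by simpa using by linarith)
    ENNReal.ofReal_ne_top
  rw [ENNReal.toReal_ofReal (by linarith)] at h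
  simpa only [Real.norm_of_nonneg (normW_nonneg _)] using h

lemma PreZ.norm_rpow (hp : 1 ≤ p) (f : PreZ X p) :
    ‖f‖ ^ p = ∫ r in Ioo (0 : ℝ) 1, normW X p r (f.toFun r) ^ p := by
  rw [PreZ.norm_def, one_div, Real.rpow_inv_rpow _ (by linarith)]
  exact integral_nonneg fun r => Real.rpow_nonneg (normW_nonneg _) _

variable (X p) in
/-- The function `w χ_(s,t)`, as a function of `w`. -/
def PreZ.step (hs : 0 < s) (hst : s < t) (ht : t < 1) : spaceW X p s →ₗ[𝕜] PreZ X p where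
  toFun w := ⟨(Ioo s t).indicator fun _ => (w : E),
    Submodule.subset_span ⟨s, t, w, hs, hst, ht, w.2, rfl⟩⟩
  map_add' v w := Subtype.ext (indicator_add _ (fun _ => (v : E)) fun _ => (w : E))
  map_smul' c w := Subtype.ext (indicator_const_smul _ c fun _ => (w : E))

lemma PreZ.toFun_step (hs : 0 < s) (hst : s < t) (ht : t < 1) (w : spaceW X p s) :
    (PreZ.step X p hs hst ht w).toFun = (Ioo s t).indicator fun _ => (w : E) := rfl

lemma PreZ.norm_step_le (hp : 1 ≤ p) (hs : 0 < s) (hst : s < t) (ht : t < 1) (w : spaceW X p s) :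
    ‖PreZ.step X p hs hst ht w‖ ≤ normW X p s w := by
  rw [← Real.rpow_le_rpow_iff (by rw [PreZ.norm_eq_toReal_eLpNorm hp]; positivity)
    (normW_nonneg _) (show 0 < p by linarith), PreZ.norm_rpow hp]
  have hC : 0 ≤ normW X p s w ^ p := Real.rpow_nonneg (normW_nonneg _) _
  refine (integral_mono_of_nonneg (Eventually.of_forall fun r => Real.rpow_nonneg (normW_nonneg _) _)
    (integrable_const (normW X p s w ^ p)) ?_).trans ?_
  · refine (ae_restrict_iff' measurableSet_Ioo).2 (Eventually.of_forall fun r hr => ?_)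
    rw [PreZ.toFun_step]
    by_cases h : r ∈ Ioo s t
    · simp only [indicator_of_mem h]
      exact Real.rpow_le_rpow (normW_nonneg _) (normW_anti hp hs h.1.le hr.2 w.2) (by linarith)
    · simpa only [indicator_of_notMem h, normW_zero, Real.zero_rpow (show p ≠ 0 by linarith)]
  · simp

lemma PreZ.induction {P : PreZ X p → Prop}
    (hstep : ∀ (s t : ℝ) (hs : 0 < s) (hst : s < t) (ht : t < 1) (w : spaceW X p s),
      P (PreZ.step X p hs hst ht w))
    (h0 : P 0) (hadd : ∀ f g, P f → P g → P (f + g)) (hsmul : ∀ (c : 𝕜) f, P f → P (c • f))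
    (f : PreZ X p) : P f := by
  obtain ⟨f, hf⟩ := f
  induction hf using Submodule.span_induction with
  | mem f hf =>
    obtain ⟨s, t, w, hs, hst, ht, hw, rfl⟩ := hf
    exact hstep s t hs hst ht ⟨w, hw⟩
  | zero => exact h0
  | add f g hf hg h1 h2 => exact hadd _ _ h1 h2
  | smul c f hf h => exact hsmul c _ h

variable [hp : Fact (2 < p)]

/-- The exponent of the L^p-norm in r is the Clarkson exponent, so the inequalities for the
individual W_r simply integrate. -/
lemma clarksonIneq_preZ (hE : ClarksonIneq E p) : ClarksonIneq (PreZ X p) p := by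
  have hp1 : 1 ≤ p := one_le_two.trans hp.out.le
  intro f g
  simp only [PreZ.norm_rpow hp1]
  rw [← integral_add (PreZ.integrable hp1 _) (PreZ.integrable hp1 _),
    ← integral_add (PreZ.integrable hp1 _) (PreZ.integrable hp1 _), ← integral_const_mul]
  refine integral_mono_ae ((PreZ.integrable hp1 _).add (PreZ.integrable hp1 _))
    (((PreZ.integrable hp1 _).add (PreZ.integrable hp1 _)).const_mul _)
    ((ae_restrict_iff' measurableSet_Ioo).2 (Eventually.of_forall fun r hr => ?_))
  exact normW_clarkson hp1 hE hr.1 hr.2 (PreZ.toFun_mem_spaceW hp1 f hr)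
    (PreZ.toFun_mem_spaceW hp1 g hr)

lemma ClarksonIneq.completion {F : Type*} [SeminormedAddCommGroup F] {p : ℝ} (hp : 0 ≤ p)
    (h : ClarksonIneq F p) : ClarksonIneq (UniformSpace.Completion F) p := by
  have hc : ∀ {g : UniformSpace.Completion F × UniformSpace.Completion F →
      UniformSpace.Completion F}, Continuous g → Continuous fun q => ‖g q‖ ^ p := fun hg =>
    (hg.norm).rpow_const fun _ => Or.inr hp
  intro u v
  refine UniformSpace.Completion.induction_on₂ u v (isClosed_le ?_ ?_) fun a b => ?_
  · exact (hc (continuous_fst.add continuous_snd)).add (hc (continuous_fst.sub continuous_snd))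
  · exact continuous_const.mul ((hc continuous_fst).add (hc continuous_snd))
  · rw [← UniformSpace.Completion.coe_add, ← UniformSpace.Completion.coe_sub]
    simp only [UniformSpace.Completion.norm_coe]
    exact h a b

theorem isReflexiveSpace_completion_preZ (hE : ClarksonIneq E p) :
    IsReflexiveSpace 𝕜 (UniformSpace.Completion (PreZ X p)) := by
  have hp0 : 0 < p := two_pos.trans hp.out
  have := ((clarksonIneq_preZ (X := X) hE).completion hp0.le).uniformConvexSpace hp0
  exact isReflexiveSpace_of_uniformConvexSpace

end PreZ

/-! ### Transferring the approximation property along an unbounded lift. -/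

section Transfer

variable {𝕜 : Type*} [RCLike 𝕜] {E Z : Type*} [NormedAddCommGroup E] [NormedSpace 𝕜 E]
  [NormedSpace ℝ E] [IsScalarTower ℝ 𝕜 E] [NormedAddCommGroup Z] [NormedSpace 𝕜 Z]

/-- On the absolutely convex hull of the `x n`, smallness in `E` forces smallness of the
corresponding combination of the `j n`. -/
def ControlsCombinations (𝕜 : Type*) [RCLike 𝕜] {E Z : Type*} [NormedAddCommGroup E]
    [NormedSpace 𝕜 E] [NormedAddCommGroup Z] [NormedSpace 𝕜 Z] (x : ℕ → E) (j : ℕ → Z) : Prop :=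
  ∀ ε : ℝ, 0 < ε → ∃ η : ℝ, 0 < η ∧ ∀ μ : ℕ →₀ 𝕜, (∑ n ∈ μ.support, ‖μ n‖) ≤ 1 →
    ‖Finsupp.linearCombination 𝕜 x μ‖ < η → ‖Finsupp.linearCombination 𝕜 j μ‖ ≤ ε

lemma sum_support_norm_le {μ : ℕ →₀ 𝕜} {I : Finset ℕ} :
    (∑ n ∈ I, ‖μ n‖) ≤ ∑ n ∈ μ.support, ‖μ n‖ := by
  classical
  rw [← Finset.sum_filter_ne_zero (s := I)]
  refine Finset.sum_le_sum_of_subset_of_nonneg (fun n hn => ?_) fun _ _ _ => norm_nonneg _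
  simpa using (Finset.mem_filter.1 hn).2

/-- A functional on `Z`, evaluated along `j`, is uniformly approximated by functionals on `E`,
evaluated along `x`. -/
lemma ControlsCombinations.exists_functional {x : ℕ → E} {j : ℕ → Z}
    (h : ControlsCombinations 𝕜 x j) (φ : Z →L[𝕜] 𝕜) {δ : ℝ} (hδ : 0 < δ) :
    ∃ ψ : E →L[𝕜] 𝕜, ∀ n, ‖ψ (x n) - φ (j n)‖ ≤ δ := by
  -- L '' P is the graph, over the absolutely convex hull of the x n, of the correspondence x n ↦ φ
  -- (j n).
  let L : (ℕ →₀ 𝕜) →ₗ[𝕜] E × 𝕜 := (Finsupp.linearCombination 𝕜 x).prod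
    ((φ : Z →ₗ[𝕜] 𝕜) ∘ₗ Finsupp.linearCombination 𝕜 j)
  let P : Set (ℕ →₀ 𝕜) := {μ | (∑ n ∈ μ.support, ‖μ n‖) ≤ 1}
  have hbal : Balanced 𝕜 (L '' P) := by
    rw [balanced_iff_smul_mem]
    rintro c hc _ ⟨μ, hμ, rfl⟩
    refine ⟨c • μ, ?_, map_smul _ _ _⟩
    calc ∑ n ∈ (c • μ).support, ‖(c • μ) n‖ ≤ ∑ n ∈ (c • μ).support, ‖μ n‖ := by
          refine Finset.sum_le_sum fun n _ => ?_
          rw [Finsupp.smul_apply, norm_smul]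
          exact mul_le_of_le_one_left (norm_nonneg _) hc
      _ ≤ 1 := sum_support_norm_le.trans hμ
  have hconv : Convex ℝ (L '' P) := by
    rintro _ ⟨μ, hμ, rfl⟩ _ ⟨ν, hν, rfl⟩ a b ha hb hab
    refine ⟨(a : 𝕜) • μ + (b : 𝕜) • ν, ?_, ?_⟩
    · set κ := (a : 𝕜) • μ + (b : 𝕜) • ν
      calc ∑ n ∈ κ.support, ‖κ n‖ ≤ ∑ n ∈ κ.support, (a * ‖μ n‖ + b * ‖ν n‖) := by
            refine Finset.sum_le_sum fun n _ => (norm_add_le _ _).trans ?_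
            simp [norm_smul, abs_of_nonneg ha, abs_of_nonneg hb]
        _ ≤ a * 1 + b * 1 := by
            rw [Finset.sum_add_distrib, ← Finset.mul_sum, ← Finset.mul_sum]
            gcongr
            · exact sum_support_norm_le.trans hμ
            · exact sum_support_norm_le.trans hν
        _ = 1 := by linarith
    · rw [map_add, map_smul, map_smul]
      simp only [← RCLike.algebraMap_eq_ofReal, algebraMap_smul]
  -- A point of the graph with small first coordinate has second coordinate at most δ/2, which is
  -- the control hypothesis applied through φ.
  have hnot : ((0, ((δ : ℝ) : 𝕜)) : E × 𝕜) ∉ closure (L '' P) := by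
    intro hcl
    have hφ : 0 < 2 * (‖φ‖ + 1) := by positivity
    obtain ⟨η, hη, hη'⟩ := h (δ / (2 * (‖φ‖ + 1))) (by positivity)
    obtain ⟨_, ⟨μ, hμ, rfl⟩, hd⟩ := Metric.mem_closure_iff.1 hcl (min η (δ / 2)) (by positivity)
    have h1 : dist (0 : E) (L μ).1 < η :=
      ((le_max_left _ _).trans_lt hd).trans_le (min_le_left _ _)
    have h2 : dist ((δ : ℝ) : 𝕜) (L μ).2 < δ / 2 :=
      ((le_max_right _ _).trans_lt hd).trans_le (min_le_right _ _)
    rw [dist_zero_left] at h1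
    have h3 : ‖(L μ).2‖ ≤ δ / 2 := by
      calc ‖(L μ).2‖ ≤ ‖φ‖ * ‖Finsupp.linearCombination 𝕜 j μ‖ := φ.le_opNorm _
        _ ≤ (‖φ‖ + 1) * (δ / (2 * (‖φ‖ + 1))) := by
          gcongr
          · linarith
          · exact hη' μ hμ h1
        _ = δ / 2 := by field_simp
    have h4 := norm_sub_norm_le ((δ : ℝ) : 𝕜) (L μ).2
    rw [RCLike.norm_ofReal, abs_of_pos hδ] at h4
    rw [dist_eq_norm] at h2
    linarith
  obtain ⟨f, hf, hf'⟩ :=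
    exists_functional_of_notMem_closure hconv hbal ⟨0, by simp [P], map_zero _⟩ hnot
  have hsplit : ∀ (u : E) (c : 𝕜), f (u, c) = f (u, 0) + c * f (0, 1) := fun u c => by
    rw [← smul_eq_mul c, ← map_smul, ← map_add]
    simp
  set q := f (0, 1) with hq
  have hq1 : 1 < δ * ‖q‖ := by
    rw [hsplit, show f ((0 : E), (0 : 𝕜)) = 0 from map_zero f, zero_add, norm_mul,
      RCLike.norm_ofReal, abs_of_pos hδ] at hf'
    exact hf'
  have hq0 : q ≠ 0 := by
    rintro h0
    rw [h0, norm_zero, mul_zero] at hq1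
    linarith
  -- On the graph |f(x n, 0) + q φ(j n)| ≤ 1; dividing by -q leaves an error of at most 1/|q| < δ.
  refine ⟨-q⁻¹ • f.comp (ContinuousLinearMap.inl 𝕜 E 𝕜), fun n => ?_⟩
  have hn : ‖f (x n, φ (j n))‖ ≤ 1 := by
    refine hf _ ⟨Finsupp.single n 1, ?_, ?_⟩
    · change ∑ m ∈ (Finsupp.single n (1 : 𝕜)).support, _ ≤ (1 : ℝ)
      rw [Finsupp.support_single n one_ne_zero]
      simp
    · simp [L]
  have he : (-q⁻¹ • f.comp (ContinuousLinearMap.inl 𝕜 E 𝕜)) (x n) - φ (j n) =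
      -q⁻¹ * f (x n, φ (j n)) := by
    rw [hsplit]
    simp only [smul_apply, ContinuousLinearMap.comp_apply, ContinuousLinearMap.inl_apply,
      smul_eq_mul]
    field_simp
    ring
  rw [he, norm_mul, norm_neg, norm_inv]
  have hqn : 0 < ‖q‖ := norm_pos_iff.2 hq0
  rw [inv_mul_le_iff₀ hqn, mul_comm]
  linarith

/-- If the `x n` lift to a null sequence in a space with the approximation property, in a way that
controls combinations, then the identity is approximable on the closed convex hull. -/
lemma ControlsCombinations.finiteRankApproxOn {x : ℕ → E} {j : ℕ → Z}
    (h : ControlsCombinations 𝕜 x j) (hj : Tendsto j atTop (𝓝 0)) (Φ : Z →L[𝕜] E)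
    (hΦ : ∀ n, Φ (j n) = x n) (hZ : HasAP 𝕜 Z) :
    FiniteRankApproxOn 𝕜 (closure (convexHull ℝ (range x))) := by
  intro ε hε
  obtain ⟨T, hT, hTj⟩ := hZ _ hj.isCompact_insert_range (ε / (4 * (‖Φ‖ + 1))) (by positivity)
  set W := LinearMap.range (T : Z →ₗ[𝕜] Z) with hW
  let b := Module.finBasis 𝕜 W
  set d := Module.finrank 𝕜 W
  let T' : Z →L[𝕜] W := T.codRestrict W fun z => LinearMap.mem_range_self _ z
  let φ : Fin d → Z →L[𝕜] 𝕜 := fun i => (LinearMap.toContinuousLinearMap (b.coord i)).comp T'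
  have hφT : ∀ z, T z = ∑ i, φ i z • (b i : Z) := fun z => by
    have := congrArg (Subtype.val) (b.sum_repr (T' z))
    simp only [Submodule.coe_sum, Submodule.coe_smul] at this
    exact this.symm
  set M := ∑ i, ‖Φ (b i)‖ with hM
  have hM0 : 0 ≤ M := Finset.sum_nonneg fun _ _ => norm_nonneg _
  choose ψ hψ using fun i => h.exists_functional (φ i) (show 0 < ε / (4 * (M + 1)) by positivity)
  -- Φ (T (j n)) is the same sum with φ i (j n) in place of ψ i (x n). Only the latter extends to a
  -- bounded operator on E.
  let R : E →L[𝕜] E := ∑ i, (ψ i).smulRight (Φ (b i))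
  have hR : ∀ u, R u = ∑ i, ψ i u • Φ (b i) := fun u => by simp [R]
  refine ⟨R, ?_, fun z hz => ?_⟩
  · have hle : LinearMap.range (R : E →ₗ[𝕜] E) ≤
        Submodule.span 𝕜 (range fun i => Φ (b i)) := by
      rintro _ ⟨u, rfl⟩
      change R u ∈ _
      rw [hR]
      exact Submodule.sum_mem _ fun i _ => Submodule.smul_mem _ _
        (Submodule.subset_span (mem_range_self i))
    have : FiniteDimensional 𝕜 (Submodule.span 𝕜 (range fun i => Φ (b i))) :=
      FiniteDimensional.span_of_finite 𝕜 (finite_range _)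
    exact Submodule.finiteDimensional_of_le hle
  -- The set where the error is at most ε/2 is closed and convex, so only the points x n need
  -- checking.
  · have hclosed : IsClosed {z : E | ‖R z - z‖ ≤ ε / 2} :=
      isClosed_le (by fun_prop) continuous_const
    have hconv : Convex ℝ {z : E | ‖R z - z‖ ≤ ε / 2} := by
      intro u hu v hv a c ha hc hac
      have hRr : ∀ (a : ℝ) (u : E), R (a • u) = a • R u := fun a u => by
        rw [← algebraMap_smul 𝕜 a u, map_smul, algebraMap_smul]
      change ‖R u - u‖ ≤ ε / 2 at hu
      change ‖R v - v‖ ≤ ε / 2 at hv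
      change ‖_‖ ≤ ε / 2
      rw [map_add, hRr, hRr, add_sub_add_comm, ← smul_sub, ← smul_sub]
      refine (norm_add_le _ _).trans ?_
      rw [norm_smul, norm_smul, Real.norm_of_nonneg ha, Real.norm_of_nonneg hc]
      calc a * ‖R u - u‖ + c * ‖R v - v‖ ≤ a * (ε / 2) + c * (ε / 2) := by gcongr
        _ = ε / 2 := by rw [← add_mul, hac, one_mul]
    have hx : range x ⊆ {z : E | ‖R z - z‖ ≤ ε / 2} := by
      rintro _ ⟨n, rfl⟩
      have h1 : ‖R (x n) - Φ (T (j n))‖ ≤ ε / 4 := by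
        rw [hR, hφT, map_sum, ← Finset.sum_sub_distrib]
        simp only [map_smul, ← sub_smul]
        calc ‖∑ i, (ψ i (x n) - φ i (j n)) • Φ (b i)‖
            ≤ ∑ i, ε / (4 * (M + 1)) * ‖Φ (b i)‖ := by
              refine norm_sum_le_of_le _ fun i _ => ?_
              rw [norm_smul]
              exact mul_le_mul_of_nonneg_right (hψ i n) (norm_nonneg _)
          _ = ε / (4 * (M + 1)) * M := by rw [← Finset.mul_sum]
          _ ≤ ε / (4 * (M + 1)) * (M + 1) := by gcongr; linarith
          _ = ε / 4 := by field_simp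
      have h2 : ‖Φ (T (j n)) - x n‖ ≤ ε / 4 := by
        rw [← hΦ n, ← map_sub]
        calc ‖Φ (T (j n) - j n)‖ ≤ ‖Φ‖ * ‖T (j n) - j n‖ := Φ.le_opNorm _
          _ ≤ (‖Φ‖ + 1) * (ε / (4 * (‖Φ‖ + 1))) := by
            gcongr
            · linarith
            · exact (hTj _ (mem_insert_of_mem _ (mem_range_self n))).le
          _ = ε / 4 := by field_simp
      have h3 := norm_add_le (R (x n) - Φ (T (j n))) (Φ (T (j n)) - x n)
      rw [sub_add_sub_cancel] at h3
      change ‖_‖ ≤ _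
      linarith
    exact (closure_minimal (convexHull_min hx hconv) hclosed hz).trans_lt (half_lt_self hε)

end Transfer

/-! ### The sequence x n inside the spaces W_t. -/

section Embedding

variable {𝕜 : Type*} [RCLike 𝕜] {E : Type*} [NormedAddCommGroup E] [NormedSpace 𝕜 E]
  [NormedSpace ℝ E] [IsScalarTower ℝ 𝕜 E] {X : ℕ → Submodule 𝕜 E} {p s t : ℝ}

lemma mem_spaceW_of_mem (hp : 1 ≤ p) (ht1 : t < 1) {k : ℕ} {w : E} (hw : w ∈ X k) :
    w ∈ spaceW X p t ∧ normW X p t w ≤ ‖w‖ / radiusV t k := by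
  classical
  have hp0 : 0 < p := by linarith
  have hX : ∀ i, (Pi.single k w : ℕ → E) i ∈ X i := fun i => by
    rcases eq_or_ne i k with rfl | h
    · simpa using hw
    · simp [h]
  have hz : ∀ i ≠ k, (‖(Pi.single k w : ℕ → E) i‖ / radiusV t i) ^ p = 0 := fun i h => by
    simp [h, Real.zero_rpow hp0.ne']
  have hw' : HasSum (Pi.single k w : ℕ → E) w := hasSum_pi_single k w
  have hs := (hasSum_single k hz).summable
  refine ⟨mem_spaceW_of_hasSum hp ht1 hX hw' hs, ?_⟩
  have h := normW_rpow_le_tsum hp ht1 hX hw' hs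
  have hr := radiusV_pos t k
  rwa [tsum_eq_single k hz, Pi.single_eq_same,
    Real.rpow_le_rpow_iff (normW_nonneg _) (by positivity) hp0] at h

lemma normW_sum_le (hp : 1 ≤ p) (ht0 : 0 < t) (ht1 : t < 1) {ι : Type*} (I : Finset ι) (w : ι → E)
    (hw : ∀ i ∈ I, w i ∈ spaceW X p t) :
    normW X p t (∑ i ∈ I, w i) ≤ ∑ i ∈ I, normW X p t (w i) := by
  classical
  induction I using Finset.induction_on with
  | empty => simp [normW_zero]
  | insert a I ha ih =>
    rw [Finset.sum_insert ha, Finset.sum_insert ha]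
    have hI : ∀ i ∈ I, w i ∈ spaceW X p t := fun i hi => hw i (Finset.mem_insert_of_mem hi)
    exact (normW_add_le hp ht0 ht1 (hw a (Finset.mem_insert_self _ _))
      (Submodule.sum_mem _ hI)).trans (add_le_add le_rfl (ih hI))

variable {x : ℕ → E} {N : ℕ → ℕ}

lemma mem_spanUpTo {n k : ℕ} (h : n < N k) : x n ∈ spanUpTo 𝕜 x N k :=
  Submodule.subset_span ⟨n, h, rfl⟩

/-- The least k with n < N k works: for k > 0 minimality gives N (k-1) ≤ n, hence ‖x n‖ < 2^(-k);
for k = 0 only ‖x n‖ ≤ 1 is needed. -/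
lemma IsAdmissible.exists_block (hx : IsAdmissible 𝕜 x N) (n : ℕ) :
    ∃ k, n < N k ∧ ‖x n‖ ≤ (1 / 2 : ℝ) ^ k := by
  classical
  have hex : ∃ k, n < N k :=
    ⟨n + 1, (hx.strictMono.id_le n).trans_lt (hx.strictMono (Nat.lt_succ_self n))⟩
  refine ⟨Nat.find hex, Nat.find_spec hex, ?_⟩
  rcases hk : Nat.find hex with _ | k
  · simpa using hx.norm_le_one n
  · exact (hx.norm_lt k n (not_lt.1 (Nat.find_min hex (by omega)))).le

lemma pow_div_radiusV (t : ℝ) (k : ℕ) :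
    (1 / 2 : ℝ) ^ k / radiusV t k = ((1 / 2 : ℝ) ^ t) ^ k := by
  have h : (0 : ℝ) < (1 / 2) ^ k := by positivity
  rw [radiusV, div_eq_iff (by positivity), ← Real.rpow_natCast ((1 / 2 : ℝ) ^ t),
    ← Real.rpow_mul (by norm_num), mul_comm t, Real.rpow_mul (by norm_num), Real.rpow_natCast,
    ← Real.rpow_add h]
  simp

lemma IsAdmissible.mem_spaceW (hx : IsAdmissible 𝕜 x N) (hp : 1 ≤ p) (ht1 : t < 1) (n : ℕ) :
    x n ∈ spaceW (spanUpTo 𝕜 x N) p t := by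
  obtain ⟨k, hk, -⟩ := hx.exists_block n
  exact (mem_spaceW_of_mem hp ht1 (mem_spanUpTo hk)).1

lemma IsAdmissible.normW_le (hx : IsAdmissible 𝕜 x N) (hp : 1 ≤ p) (ht0 : 0 < t) (ht1 : t < 1)
    {n K : ℕ} (hn : N K ≤ n) : normW (spanUpTo 𝕜 x N) p t (x n) ≤ ((1 / 2 : ℝ) ^ t) ^ K := by
  obtain ⟨k, hk, hk'⟩ := hx.exists_block n
  refine (mem_spaceW_of_mem hp ht1 (mem_spanUpTo hk)).2.trans ?_
  have hr := radiusV_pos t k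
  calc ‖x n‖ / radiusV t k ≤ (1 / 2 : ℝ) ^ k / radiusV t k := by gcongr
    _ = ((1 / 2 : ℝ) ^ t) ^ k := pow_div_radiusV t k
    _ ≤ _ := pow_le_pow_of_le_one (by positivity) (half_rpow_lt_one ht0).le
      (hx.strictMono.lt_iff_lt.1 (hn.trans_lt hk)).le

lemma IsAdmissible.tendsto_normW (hx : IsAdmissible 𝕜 x N) (hp : 1 ≤ p) (ht0 : 0 < t)
    (ht1 : t < 1) : Tendsto (fun n => normW (spanUpTo 𝕜 x N) p t (x n)) atTop (𝓝 0) := by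
  rw [Metric.tendsto_atTop]
  intro ε hε
  obtain ⟨K, hK⟩ := exists_pow_lt_of_lt_one hε (half_rpow_lt_one ht0)
  refine ⟨N K, fun n hn => ?_⟩
  rw [Real.dist_0_eq_abs, abs_of_nonneg (normW_nonneg _)]
  exact (hx.normW_le hp ht0 ht1 hn).trans_lt hK

/-- On the absolutely convex hull of the `x n`, smallness in `E` forces smallness in `W_t`. -/
lemma IsAdmissible.normW_linearCombination_le (hx : IsAdmissible 𝕜 x N) (hp : 1 ≤ p)
    (ht0 : 0 < t) (ht1 : t < 1) {μ : ℕ →₀ 𝕜} (hμ : (∑ n ∈ μ.support, ‖μ n‖) ≤ 1) (K : ℕ) :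
    normW (spanUpTo 𝕜 x N) p t (Finsupp.linearCombination 𝕜 x μ) ≤
      ‖Finsupp.linearCombination 𝕜 x μ‖ / radiusV t K + 2 * ((1 / 2 : ℝ) ^ t) ^ K := by
  classical
  set u := Finsupp.linearCombination 𝕜 x μ with hu
  have hr := radiusV_pos t K
  -- The head H lies in X_K, where the norm of W_t is at most that of E divided by ρ_K(t). The tail
  -- L is small in both norms: 2^(-K) in E and 2^(-tK) in W_t. Since H = u - L and 2^(-K)/ρ_K(t) =
  -- 2^(-tK), the tail contributes twice.
  set H := ∑ n ∈ μ.support with n < N K, μ n • x n with hH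
  set L := ∑ n ∈ μ.support with ¬ n < N K, μ n • x n with hL
  have hHL : u = H + L := by
    rw [hu, Finsupp.linearCombination_apply, Finsupp.sum, hH, hL,
      Finset.sum_filter_add_sum_filter_not]
  have hHX : H ∈ spanUpTo 𝕜 x N K := Submodule.sum_mem _ fun n hn =>
    Submodule.smul_mem _ _ (mem_spanUpTo (Finset.mem_filter.1 hn).2)
  have hxW := hx.mem_spaceW (p := p) (t := t) hp ht1
  have hLW : L ∈ spaceW (spanUpTo 𝕜 x N) p t :=
    Submodule.sum_mem _ fun n _ => Submodule.smul_mem _ _ (hxW n)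
  have hLn : normW (spanUpTo 𝕜 x N) p t L ≤ ((1 / 2 : ℝ) ^ t) ^ K := by
    calc normW (spanUpTo 𝕜 x N) p t L
        ≤ ∑ n ∈ μ.support with ¬ n < N K, normW (spanUpTo 𝕜 x N) p t (μ n • x n) :=
          normW_sum_le hp ht0 ht1 _ _ fun n _ => Submodule.smul_mem _ _ (hxW n)
      _ ≤ ∑ n ∈ μ.support with ¬ n < N K, ‖μ n‖ * ((1 / 2 : ℝ) ^ t) ^ K := by
          refine Finset.sum_le_sum fun n hn => ?_
          rw [normW_smul hp]
          exact mul_le_mul_of_nonneg_left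
            (hx.normW_le hp ht0 ht1 (not_lt.1 (Finset.mem_filter.1 hn).2)) (norm_nonneg _)
      _ ≤ 1 * ((1 / 2 : ℝ) ^ t) ^ K := by
          rw [← Finset.sum_mul]
          gcongr
          exact sum_support_norm_le.trans hμ
      _ = _ := one_mul _
  have hLn' : ‖L‖ ≤ (1 / 2 : ℝ) ^ K := by
    calc ‖L‖ ≤ ∑ n ∈ μ.support with ¬ n < N K, ‖μ n‖ * (1 / 2 : ℝ) ^ K := by
          refine norm_sum_le_of_le _ fun n hn => ?_
          rw [norm_smul]
          refine mul_le_mul_of_nonneg_left ?_ (norm_nonneg _)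
          exact (hx.norm_lt K n (not_lt.1 (Finset.mem_filter.1 hn).2)).le.trans
            (pow_le_pow_of_le_one (by norm_num) (by norm_num) (by omega))
      _ ≤ 1 * (1 / 2 : ℝ) ^ K := by
          rw [← Finset.sum_mul]
          gcongr
          exact sum_support_norm_le.trans hμ
      _ = _ := one_mul _
  have hHn : ‖H‖ ≤ ‖u‖ + (1 / 2 : ℝ) ^ K := by
    have : H = u - L := by rw [hHL, add_sub_cancel_right]
    rw [this]
    exact (norm_sub_le _ _).trans (by gcongr)
  have hHm := mem_spaceW_of_mem (p := p) (t := t) hp ht1 hHX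
  calc normW (spanUpTo 𝕜 x N) p t u
      ≤ normW (spanUpTo 𝕜 x N) p t H + normW (spanUpTo 𝕜 x N) p t L := by
        rw [hHL]; exact normW_add_le hp ht0 ht1 hHm.1 hLW
    _ ≤ (‖u‖ + (1 / 2 : ℝ) ^ K) / radiusV t K + ((1 / 2 : ℝ) ^ t) ^ K := by
        refine add_le_add (hHm.2.trans ?_) hLn
        gcongr
    _ = _ := by rw [add_div, pow_div_radiusV]; ring

end Embedding

/-! ### Integration back to E, and failure of the approximation property. -/

section Integration

variable {𝕜 : Type*} [RCLike 𝕜] {E : Type*} [NormedAddCommGroup E] [NormedSpace 𝕜 E]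
  [NormedSpace ℝ E] [IsScalarTower ℝ 𝕜 E] {X : ℕ → Submodule 𝕜 E} {p s t : ℝ}

/-- A bounded linear map extends to the completion with the same bound. -/
lemma exists_extension_completion {G F : Type*} [SeminormedAddCommGroup G] [NormedSpace 𝕜 G]
    [NormedAddCommGroup F] [NormedSpace 𝕜 F] [CompleteSpace F] (L : G →ₗ[𝕜] F) (C : ℝ)
    (hL : ∀ g, ‖L g‖ ≤ C * ‖g‖) :
    ∃ T : UniformSpace.Completion G →L[𝕜] F,
      (∀ g : G, T g = L g) ∧ ∀ z, ‖T z‖ ≤ C * ‖z‖ := by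
  have he : ∀ g : G, (L.mkContinuous C hL).extend UniformSpace.Completion.toComplL
      (g : UniformSpace.Completion G) = L g := fun g =>
    ContinuousLinearMap.extend_eq (e := UniformSpace.Completion.toComplL (𝕜 := 𝕜) (E := G)) _
      UniformSpace.Completion.denseRange_coe
      (UniformSpace.Completion.isUniformInducing_coe G) g
  refine ⟨(L.mkContinuous C hL).extend UniformSpace.Completion.toComplL, he, fun z => ?_⟩
  refine UniformSpace.Completion.induction_on z (isClosed_le ?_ ?_) fun g => ?_
  · exact ((L.mkContinuous C hL).extend UniformSpace.Completion.toComplL).continuous.norm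
  · exact continuous_const.mul continuous_norm
  · rw [he, UniformSpace.Completion.norm_coe]
    exact hL g

lemma PreZ.integrable_normW (hp : 1 ≤ p) (f : PreZ X p) :
    IntegrableOn (fun r => normW X p r (f.toFun r)) (Ioo (0 : ℝ) 1) :=
  (PreZ.memLp hp f).integrable (by simpa using hp)

lemma PreZ.integrableOn (hp : 1 ≤ p) (f : PreZ X p) (a b : ℝ) :
    IntegrableOn f.toFun (Ioo a b) := by
  obtain ⟨⟨F, hF⟩, -⟩ := stepFunctions_props hp f.toFun_mem
  rw [← hF]
  exact F.integrable_of_isFiniteMeasure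

/-- Jensen's inequality for the averages over an interval. -/
lemma rpow_average_le {a b : ℝ} (hab : a < b) (hp : 1 ≤ p) {g : ℝ → ℝ} (hg0 : ∀ r, 0 ≤ g r)
    (hg : IntegrableOn g (Ioo a b)) (hgp : IntegrableOn (fun r => g r ^ p) (Ioo a b)) :
    ((b - a)⁻¹ * ∫ r in Ioo a b, g r) ^ p ≤ (b - a)⁻¹ * ∫ r in Ioo a b, g r ^ p := by
  have h := (convexOn_rpow hp).map_set_average_le (t := Ioo a b) (μ := volume) (f := g)
    (Real.continuous_rpow_const (by linarith)).continuousOn isClosed_Ici (by simpa using hab)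
    (by simp) (Eventually.of_forall hg0) hg hgp
  simpa [setAverage_eq, abs_of_pos (sub_pos.2 hab), Measure.real, Real.volume_Ioo,
    ENNReal.toReal_ofReal (sub_pos.2 hab).le] using h

variable [hp : Fact (2 < p)]

lemma PreZ.integral_normW_le (f : PreZ X p) :
    ∫ r in Ioo (0 : ℝ) 1, normW X p r (f.toFun r) ≤ ‖f‖ := by
  have hp1 : 1 ≤ p := one_le_two.trans hp.out.le
  rw [← Real.rpow_le_rpow_iff (integral_nonneg fun r => normW_nonneg _) (norm_nonneg _)
    (show 0 < p by linarith), PreZ.norm_rpow hp1]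
  simpa using rpow_average_le one_pos hp1 (fun r => normW_nonneg (X := X) (f.toFun r))
    (PreZ.integrable_normW hp1 f) (PreZ.integrable hp1 f)

/-- Integration over an interval away from `1` is bounded from the step functions to `E`. -/
lemma PreZ.exists_integral_bound (hs : 0 < s) (ht : t < 1) :
    ∃ C : ℝ, ∀ f : PreZ X p, ‖∫ r in Ioo s t, f.toFun r‖ ≤ C * ‖f‖ := by
  have hp1 : 1 ≤ p := one_le_two.trans hp.out.le
  rcases le_or_gt t 0 with h0 | ht0
  · exact ⟨0, fun f => by simp [Ioo_eq_empty (show ¬ s < t by linarith)]⟩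
  -- For r < t, W_r is contained in W_t with smaller norm there, and W_t embeds in E with constant
  -- C. The series converges because t < 1.
  set C := ∑' k, radiusV t k with hC
  have hC0 : 0 ≤ C := tsum_radiusV_nonneg t
  refine ⟨C, fun f => ?_⟩
  have hsub : Ioo s t ⊆ Ioo 0 1 := Ioo_subset_Ioo hs.le ht.le
  calc ‖∫ r in Ioo s t, f.toFun r‖ ≤ ∫ r in Ioo s t, C * normW X p r (f.toFun r) := by
        refine norm_integral_le_of_norm_le
          (((PreZ.integrable_normW hp1 f).mono_set hsub).const_mul C)
          ((ae_restrict_iff' measurableSet_Ioo).2 (Eventually.of_forall fun r hr => ?_))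
        have hW := PreZ.toFun_mem_spaceW hp1 f (hsub hr)
        have hr0 : 0 < r := hs.trans hr.1
        refine (norm_le_mul_normW hp1 ht0 ht (spaceW_mono hr.2.le ht hW)).trans ?_
        exact mul_le_mul_of_nonneg_left (normW_anti hp1 hr0 hr.2.le ht hW) hC0
    _ = C * ∫ r in Ioo s t, normW X p r (f.toFun r) := integral_const_mul _ _
    _ ≤ C * ∫ r in Ioo (0 : ℝ) 1, normW X p r (f.toFun r) := by
        refine mul_le_mul_of_nonneg_left ?_ hC0
        exact setIntegral_mono_set (PreZ.integrable_normW hp1 f)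
          (Eventually.of_forall fun r => normW_nonneg _) (LE.le.eventuallyLE hsub)
    _ ≤ C * ‖f‖ := mul_le_mul_of_nonneg_left (PreZ.integral_normW_le f) hC0

variable (X p) in
/-- Integration over an interval, as a linear map on the step functions. -/
def PreZ.integralMap [CompleteSpace E] (a b : ℝ) : PreZ X p →ₗ[𝕜] E where
  toFun f := ∫ r in Ioo a b, f.toFun r
  map_add' f g := integral_add (PreZ.integrableOn (one_le_two.trans hp.out.le) f a b)
    (PreZ.integrableOn (one_le_two.trans hp.out.le) g a b)
  map_smul' c f := integral_smul c f.toFun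

lemma PreZ.integralMap_apply [CompleteSpace E] (a b : ℝ) (f : PreZ X p) :
    PreZ.integralMap X p a b f = ∫ r in Ioo a b, f.toFun r := rfl

theorem IsAdmissible.not_hasAP [CompleteSpace E] {x : ℕ → E} {N : ℕ → ℕ}
    (hx : IsAdmissible 𝕜 x N) : ¬ HasAP 𝕜 (ZSharp 𝕜 p x N) := by
  have hp1 : 1 ≤ p := one_le_two.trans hp.out.le
  intro hZ
  have h0 : (0 : ℝ) < 1 / 4 := by norm_num
  have h1 : (1 / 4 : ℝ) < 1 / 2 := by norm_num
  have h2 : (1 / 2 : ℝ) < 1 := by norm_num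
  have h3 : (1 / 4 : ℝ) < 1 := by norm_num
  have hxW := hx.mem_spaceW (p := p) hp1 h3
  let w : ℕ → spaceW (spanUpTo 𝕜 x N) p (1 / 4) := fun n => ⟨x n, hxW n⟩
  let S := PreZ.step (spanUpTo 𝕜 x N) p h0 h1 h2
  let J : spaceW (spanUpTo 𝕜 x N) p (1 / 4) →ₗ[𝕜] ZSharp 𝕜 p x N :=
    (UniformSpace.Completion.toComplL (𝕜 := 𝕜) :
      PreZ (spanUpTo 𝕜 x N) p →L[𝕜] ZSharp 𝕜 p x N).toLinearMap ∘ₗ S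
  have hJ : ∀ v, ‖J v‖ ≤ normW (spanUpTo 𝕜 x N) p (1 / 4) v := fun v => by
    change ‖((S v : PreZ (spanUpTo 𝕜 x N) p) : ZSharp 𝕜 p x N)‖ ≤ _
    rw [UniformSpace.Completion.norm_coe]
    exact PreZ.norm_step_le hp1 h0 h1 h2 v
  have hctrl : ControlsCombinations 𝕜 x fun n => J (w n) := by
    intro ε hε
    obtain ⟨K, hK⟩ := exists_pow_lt_of_lt_one (show 0 < ε / 4 by positivity) (half_rpow_lt_one h0)
    have hr := radiusV_pos (1 / 4) K
    -- The head term is then below ε/2, and the choice of K bounds the tail term by 2·ε/4.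
    refine ⟨ε / 2 * radiusV (1 / 4) K, by positivity, fun μ hμ hμ' => ?_⟩
    have hlin : Finsupp.linearCombination 𝕜 (fun n => J (w n)) μ =
        J (Finsupp.linearCombination 𝕜 w μ) := by
      simp only [Finsupp.linearCombination_apply, Finsupp.sum, map_sum, map_smul]
    have hval : ((Finsupp.linearCombination 𝕜 w μ :) : E) = Finsupp.linearCombination 𝕜 x μ := by
      simp only [Finsupp.linearCombination_apply, Finsupp.sum, Submodule.coe_sum,
        Submodule.coe_smul, w]
    rw [hlin]
    refine (hJ _).trans ?_
    rw [hval]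
    refine (hx.normW_linearCombination_le hp1 h0 h3 hμ K).trans ?_
    have := (div_lt_iff₀ hr).2 hμ'
    linarith
  have hj : Tendsto (fun n => J (w n)) atTop (𝓝 0) :=
    squeeze_zero_norm (fun n => hJ (w n)) (hx.tendsto_normW hp1 h0 h3)
  obtain ⟨C, hC⟩ := PreZ.exists_integral_bound (X := spanUpTo 𝕜 x N) (p := p) h0 h2
  obtain ⟨Φ, hΦ, -⟩ := exists_extension_completion
    (PreZ.integralMap (spanUpTo 𝕜 x N) p (1 / 4) (1 / 2)) C hC
  -- The factor 4 is the reciprocal of the length of (1/4, 1/2).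
  have hΦx : ∀ n, ((4 : 𝕜) • Φ) (J (w n)) = x n := fun n => by
    change (4 : 𝕜) • Φ ((S (w n) : PreZ (spanUpTo 𝕜 x N) p) : ZSharp 𝕜 p x N) = x n
    rw [hΦ, PreZ.integralMap_apply, PreZ.toFun_step,
      setIntegral_congr_fun (g := fun _ => x n) measurableSet_Ioo fun r hr => indicator_of_mem hr _,
      setIntegral_const, Measure.real, Real.volume_Ioo, ENNReal.toReal_ofReal (by norm_num),
      ← algebraMap_smul 𝕜 ((1 : ℝ) / 2 - 1 / 4), smul_smul]
    have : (4 : 𝕜) * algebraMap ℝ 𝕜 (1 / 2 - 1 / 4) = 1 := by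
      rw [show (1 / 2 - 1 / 4 : ℝ) = 4⁻¹ by norm_num, RCLike.algebraMap_eq_ofReal]
      push_cast
      exact mul_inv_cancel₀ (by norm_num)
    rw [this, one_smul]
  exact hx.not_approx (hctrl.finiteRankApproxOn hj _ hΦx hZ)

end Integration

/-! ### Compactness of the inclusions W_s → W_t for s < t. -/

section Compactness

lemma totallyBounded_of_forall_exists_isCompact {α : Type*} [PseudoMetricSpace α] {A : Set α}
    (h : ∀ ε : ℝ, 0 < ε → ∃ C : Set α, IsCompact C ∧ ∀ z ∈ A, ∃ c ∈ C, dist z c < ε) :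
    TotallyBounded A := by
  rw [Metric.totallyBounded_iff]
  intro ε hε
  obtain ⟨C, hC, hA⟩ := h (ε / 2) (half_pos hε)
  obtain ⟨t, ht, htC⟩ := Metric.totallyBounded_iff.1 hC.totallyBounded (ε / 2) (half_pos hε)
  refine ⟨t, ht, fun z hz => ?_⟩
  obtain ⟨c, hc, hzc⟩ := hA z hz
  obtain ⟨y, hy, hcy⟩ := mem_iUnion₂.1 (htC hc)
  refine mem_iUnion₂.2 ⟨y, hy, ?_⟩
  have h1 := dist_triangle z c y
  rw [Metric.mem_ball] at hcy ⊢
  linarith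

variable {𝕜 : Type*} [RCLike 𝕜] {E : Type*} [NormedAddCommGroup E] [NormedSpace 𝕜 E]
  [NormedSpace ℝ E] [IsScalarTower ℝ 𝕜 E] {X : ℕ → Submodule 𝕜 E} {p s t : ℝ}

/-- For `s < t` an element of `W_s` is close, in the norm of `W_t`, to a bounded part of some
`X_K`, uniformly on bounded sets. -/
lemma exists_head_of_normW_lt (hp : 1 ≤ p) (hX : Monotone X) (hs : 0 < s) (hst : s < t)
    (ht : t < 1) {w : E} (hw : w ∈ spaceW X p s) {C : ℝ} (hC : normW X p s w < C) (K : ℕ) :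
    ∃ u ∈ X K, ‖u‖ ≤ C * ∑' k, radiusV s k ∧
      normW X p t (w - u) ≤ ((1 / 2 : ℝ) ^ (t - s)) ^ K * C := by
  classical
  have hp0 : 0 < p := by linarith
  have hC0 : 0 ≤ C := (normW_nonneg w).trans hC.le
  obtain ⟨b, b1, b2, b3, b4⟩ := exists_hasSum_of_normW_lt hp hs (hst.trans ht) hw hC
  have hbn := norm_le_of_tsum_le hp b3 hC0 b4
  refine ⟨∑ k ∈ Finset.range K, b k, Submodule.sum_mem _ fun k hk =>
    hX (Finset.mem_range.1 hk).le (b1 k), ?_, ?_⟩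
  · calc ‖∑ k ∈ Finset.range K, b k‖ ≤ ∑ k ∈ Finset.range K, C * radiusV s k :=
          norm_sum_le_of_le _ fun k _ => hbn k
      _ ≤ C * ∑' k, radiusV s k := by
          rw [← Finset.mul_sum]
          exact mul_le_mul_of_nonneg_left ((summable_radiusV (hst.trans ht)).sum_le_tsum _
            fun k _ => (radiusV_pos s k).le) hC0
  · set δ : ℝ := ((1 / 2 : ℝ) ^ (t - s)) ^ K with hδ
    have hδ0 : 0 ≤ δ := by positivity
    let c : ℕ → E := fun k => if k < K then 0 else b k
    have hc : HasSum c (w - ∑ k ∈ Finset.range K, b k) := by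
      have h1 : HasSum (fun k => if k < K then b k else 0) (∑ k ∈ Finset.range K, b k) := by
        have h2 : HasSum (fun k => if k < K then b k else 0)
            (∑ k ∈ Finset.range K, if k < K then b k else 0) :=
          hasSum_sum_of_ne_finset_zero fun k hk => if_neg (by simpa using hk)
        rwa [Finset.sum_congr rfl fun k hk => if_pos (Finset.mem_range.1 hk)] at h2
      refine (b2.sub h1).congr_fun fun k => ?_
      by_cases h : k < K <;> simp [c, h]
    have hcX : ∀ k, c k ∈ X k := fun k => by
      by_cases h : k < K
      · simp [c, h]
      · simpa [c, h] using b1 k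
    -- For k ≥ K the ratio of the weights is at most δ, so passing from W_s to W_t gains the factor
    -- δ on the tail c.
    have hrad : ∀ k, radiusV s k = ((1 / 2 : ℝ) ^ (t - s)) ^ k * radiusV t k := fun k => by
      rw [radiusV_eq_pow, radiusV_eq_pow, ← mul_pow, ← Real.rpow_add (by norm_num)]
      congr 2; ring
    have hle : ∀ k, (‖c k‖ / radiusV t k) ^ p ≤ δ ^ p * (‖b k‖ / radiusV s k) ^ p := fun k => by
      have hrs := radiusV_pos s k
      have hrt := radiusV_pos t k
      by_cases h : k < K
      · simp only [c, h, if_true, norm_zero, zero_div, Real.zero_rpow hp0.ne']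
        positivity
      · rw [← Real.mul_rpow hδ0 (by positivity)]
        refine Real.rpow_le_rpow (by positivity) ?_ hp0.le
        simp only [c, h, if_false]
        rw [hrad k, div_le_iff₀ hrt]
        have hq : 0 < ((1 / 2 : ℝ) ^ (t - s)) ^ k := by positivity
        have hqδ : ((1 / 2 : ℝ) ^ (t - s)) ^ k ≤ δ := pow_le_pow_of_le_one (by positivity)
          (half_rpow_lt_one (by linarith)).le (not_lt.1 h)
        have : δ * (‖b k‖ / (((1 / 2 : ℝ) ^ (t - s)) ^ k * radiusV t k)) * radiusV t k =
            δ / ((1 / 2 : ℝ) ^ (t - s)) ^ k * ‖b k‖ := by field_simp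
        rw [this]
        exact le_mul_of_one_le_left (norm_nonneg _) ((one_le_div hq).2 hqδ)
    have hsum : Summable fun k => (‖c k‖ / radiusV t k) ^ p :=
      Summable.of_nonneg_of_le (fun k => by have := radiusV_pos t k; positivity) hle
        (b3.mul_left _)
    have h1 := normW_rpow_le_tsum hp ht hcX hc hsum
    have h2 : normW X p t (w - ∑ k ∈ Finset.range K, b k) ^ p ≤ (δ * C) ^ p := by
      rw [Real.mul_rpow hδ0 hC0]
      refine h1.trans ((hsum.tsum_le_tsum hle (b3.mul_left _)).trans ?_)
      rw [tsum_mul_left]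
      gcongr
    rwa [Real.rpow_le_rpow_iff (normW_nonneg _) (by positivity) hp0] at h2

variable [hp : Fact (2 < p)]

/-- Bounded subsets of `W_b` give totally bounded sets of functions `w χ_(s,t)` if `b < s`. -/
lemma totallyBounded_image_step {b : ℝ} (hX : Monotone X) (hXf : ∀ k, FiniteDimensional 𝕜 (X k))
    (hb : 0 < b) (hbs : b < s) (hst : s < t) (ht : t < 1) (C : ℝ) :
    TotallyBounded ((fun w : spaceW X p s =>
      (PreZ.step X p (hb.trans hbs) hst ht w : UniformSpace.Completion (PreZ X p))) ''
        {w | (w : E) ∈ spaceW X p b ∧ normW X p b w < C}) := by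
  have hp1 : 1 ≤ p := one_le_two.trans hp.out.le
  rcases le_or_gt C 0 with hC | hC
  · have : {w : spaceW X p s | (w : E) ∈ spaceW X p b ∧ normW X p b w < C} = ∅ := by
      ext w
      simp only [mem_ofPred_eq, mem_empty_iff_false, iff_false, not_and, not_lt]
      exact fun _ => hC.trans (normW_nonneg _)
    rw [this, image_empty]
    exact totallyBounded_empty
  refine totallyBounded_of_forall_exists_isCompact fun ε hε => ?_
  obtain ⟨K, hK⟩ := exists_pow_lt_of_lt_one (show 0 < ε / C by positivity)
    (half_rpow_lt_one (sub_pos.2 hbs))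
  have hs1 : s < 1 := hst.trans ht
  let ι : X K →ₗ[𝕜] spaceW X p s :=
    Submodule.inclusion fun w hw => (mem_spaceW_of_mem hp1 hs1 hw).1
  let J : X K →ₗ[𝕜] UniformSpace.Completion (PreZ X p) :=
    (UniformSpace.Completion.toComplL (𝕜 := 𝕜) :
      PreZ X p →L[𝕜] UniformSpace.Completion (PreZ X p)).toLinearMap ∘ₗ
      PreZ.step X p (hb.trans hbs) hst ht ∘ₗ ι
  have := hXf K
  have : ProperSpace (X K) := FiniteDimensional.proper 𝕜 (X K)
  have hJ : Continuous J := J.continuous_of_finiteDimensional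
  refine ⟨J '' Metric.closedBall 0 (C * ∑' k, radiusV b k),
    (isCompact_closedBall _ _).image hJ, ?_⟩
  rintro _ ⟨w, ⟨hwb, hwC⟩, rfl⟩
  obtain ⟨u, hu, hun, huw⟩ := exists_head_of_normW_lt hp1 hX hb hbs hs1 hwb hwC K
  refine ⟨_, ⟨⟨u, hu⟩, by simpa using hun, rfl⟩, ?_⟩
  change dist ((PreZ.step X p (hb.trans hbs) hst ht w : PreZ X p) :
    UniformSpace.Completion (PreZ X p)) ((PreZ.step X p (hb.trans hbs) hst ht (ι ⟨u, hu⟩) :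
      PreZ X p) : UniformSpace.Completion (PreZ X p)) < ε
  rw [dist_eq_norm, ← UniformSpace.Completion.coe_sub, UniformSpace.Completion.norm_coe, ← map_sub]
  refine (PreZ.norm_step_le hp1 (hb.trans hbs) hst ht (w - ι ⟨u, hu⟩)).trans_lt ?_
  exact huw.trans_lt ((lt_div_iff₀ hC).1 hK)

end Compactness

/-! ### Averages of step functions and compact block operators. -/

section Averages

variable {𝕜 : Type*} [RCLike 𝕜] {E : Type*} [NormedAddCommGroup E] [NormedSpace 𝕜 E]
  [NormedSpace ℝ E] [IsScalarTower ℝ 𝕜 E] [CompleteSpace E] {X : ℕ → Submodule 𝕜 E}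
  {p a b s t : ℝ}

/-- The integral of a step function is a finite sum, so the triangle inequality in W_b suffices and
no vector integration in W_b is needed. Values not taken on (a,b) may lie outside W_b, but their
coefficients vanish. -/
lemma PreZ.integral_mem_and_normW_le (hp : 1 ≤ p) (f : PreZ X p) (ha : 0 ≤ a) (hb0 : 0 < b)
    (hb : b < 1) :
    ∫ r in Ioo a b, f.toFun r ∈ spaceW X p b ∧
      normW X p b (∫ r in Ioo a b, f.toFun r) ≤ ∫ r in Ioo a b, normW X p r (f.toFun r) := by
  have hsub : Ioo a b ⊆ Ioo 0 1 := Ioo_subset_Ioo ha hb.le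
  obtain ⟨⟨F, hF⟩, -⟩ := stepFunctions_props hp f.toFun_mem
  have hFi : Integrable F (volume.restrict (Ioo a b)) := F.integrable_of_isFiniteMeasure
  have hW : ∀ r ∈ Ioo a b, f.toFun r ∈ spaceW X p b := fun r hr =>
    spaceW_mono hr.2.le hb (PreZ.toFun_mem_spaceW hp f (hsub hr))
  set ν := volume.restrict (Ioo a b) with hν
  have hval : ∀ y, ν.real (F ⁻¹' {y}) • y ∈ spaceW X p b := fun y => by
    rcases (F ⁻¹' {y} ∩ Ioo a b).eq_empty_or_nonempty with h | ⟨r, hr, hr'⟩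
    · have : ν.real (F ⁻¹' {y}) = 0 := by
        rw [hν, measureReal_restrict_apply (F.measurableSet_fiber y), h, measureReal_empty]
      rw [this, zero_smul]
      exact Submodule.zero_mem _
    · have hry : F r = y := hr
      rw [← hry, hF]
      exact spaceW_smul_mem _ (hW r hr')
  have hint : ∫ r in Ioo a b, f.toFun r = ∑ y ∈ F.range, ν.real (F ⁻¹' {y}) • y := by
    rw [← hF]
    exact F.integral_eq_sum hFi
  have hG : ∫ r in Ioo a b, normW X p b (F r) =
      ∑ y ∈ F.range, ν.real (F ⁻¹' {y}) • normW X p b y := by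
    rw [← F.map_integral _ hFi normW_zero]
    exact ((F.map (normW X p b)).integral_eq_integral
      (SimpleFunc.integrable_of_isFiniteMeasure _)).symm
  rw [hint]
  refine ⟨Submodule.sum_mem _ fun y _ => hval y, ?_⟩
  calc normW X p b (∑ y ∈ F.range, ν.real (F ⁻¹' {y}) • y)
      ≤ ∑ y ∈ F.range, normW X p b (ν.real (F ⁻¹' {y}) • y) :=
        normW_sum_le hp hb0 hb _ _ fun y _ => hval y
    _ = ∫ r in Ioo a b, normW X p b (f.toFun r) := by
        rw [← hF, hG]
        refine Finset.sum_congr rfl fun y _ => ?_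
        rw [normW_real_smul hp, abs_of_nonneg measureReal_nonneg, smul_eq_mul]
    _ ≤ ∫ r in Ioo a b, normW X p r (f.toFun r) := by
        refine integral_mono_of_nonneg (Eventually.of_forall fun r => normW_nonneg _)
          ((PreZ.integrable_normW hp f).mono_set hsub)
          ((ae_restrict_iff' measurableSet_Ioo).2 (Eventually.of_forall fun r hr => ?_))
        exact normW_anti hp (ha.trans_lt hr.1) hr.2.le hb (PreZ.toFun_mem_spaceW hp f (hsub hr))

/-- The average of a step function over an interval. -/
def PreZ.avg (a b : ℝ) (f : PreZ X p) : E :=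
  (((b - a)⁻¹ : ℝ) : 𝕜) • ∫ r in Ioo a b, f.toFun r

lemma PreZ.avg_mem (hp : 1 ≤ p) (f : PreZ X p) (ha : 0 ≤ a) (hab : a < b) (hb : b < 1) :
    f.avg a b ∈ spaceW X p b :=
  Submodule.smul_mem _ _ (PreZ.integral_mem_and_normW_le hp f ha (ha.trans_lt hab) hb).1

lemma PreZ.normW_avg_le (hp : 1 ≤ p) (f : PreZ X p) (ha : 0 ≤ a) (hab : a < b) (hb : b < 1) :
    normW X p b (f.avg a b) ≤ (b - a)⁻¹ * ∫ r in Ioo a b, normW X p r (f.toFun r) := by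
  have hba : 0 < (b - a)⁻¹ := inv_pos.2 (sub_pos.2 hab)
  rw [PreZ.avg, normW_smul hp, RCLike.norm_ofReal, abs_of_pos hba]
  exact mul_le_mul_of_nonneg_left
    (PreZ.integral_mem_and_normW_le hp f ha (ha.trans_lt hab) hb).2 hba.le

variable [hp : Fact (2 < p)]

variable (X p) in
/-- The operator which averages over `(a,b)` and puts the result on `(s,t)`. -/
def PreZ.blockMap (ha : 0 ≤ a) (hab : a < b) (hbs : b < s) (hst : s < t) (ht : t < 1) :
    PreZ X p →ₗ[𝕜] PreZ X p :=
  PreZ.step X p ((ha.trans_lt hab).trans hbs) hst ht ∘ₗ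
    LinearMap.codRestrict (spaceW X p s) ((((b - a)⁻¹ : ℝ) : 𝕜) • PreZ.integralMap X p a b)
      fun f => spaceW_mono hbs.le (hst.trans ht) (PreZ.avg_mem (one_le_two.trans hp.out.le) f ha hab
        ((hbs.trans hst).trans ht))

lemma PreZ.exists_isCompactOperator_blockMap (hX : Monotone X)
    (hXf : ∀ k, FiniteDimensional 𝕜 (X k)) (ha : 0 ≤ a) (hab : a < b) (hbs : b < s)
    (hst : s < t) (ht : t < 1) :
    ∃ T : UniformSpace.Completion (PreZ X p) →L[𝕜] UniformSpace.Completion (PreZ X p),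
      IsCompactOperator T ∧ ∀ f : PreZ X p, T f = PreZ.blockMap X p ha hab hbs hst ht f := by
  have hp1 : 1 ≤ p := one_le_two.trans hp.out.le
  have hb0 : 0 < b := ha.trans_lt hab
  have hs1 : s < 1 := hst.trans ht
  have hb1 : b < 1 := hbs.trans hs1
  have hba : 0 < (b - a)⁻¹ := inv_pos.2 (sub_pos.2 hab)
  have havg : ∀ f : PreZ X p, normW X p b (f.avg a b) ≤ (b - a)⁻¹ * ‖f‖ := fun f => by
    refine (PreZ.normW_avg_le hp1 f ha hab hb1).trans (mul_le_mul_of_nonneg_left ?_ hba.le)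
    refine le_trans ?_ (PreZ.integral_normW_le f)
    exact setIntegral_mono_set (PreZ.integrable_normW hp1 f)
      (Eventually.of_forall fun r => normW_nonneg _)
      (LE.le.eventuallyLE (Ioo_subset_Ioo ha hb1.le))
  let w : PreZ X p → spaceW X p s := fun f =>
    ⟨f.avg a b, spaceW_mono hbs.le hs1 (PreZ.avg_mem hp1 f ha hab hb1)⟩
  have hBw : ∀ f, PreZ.blockMap X p ha hab hbs hst ht f =
      PreZ.step X p (hb0.trans hbs) hst ht (w f) := fun f => rfl
  obtain ⟨T, hT, -⟩ := exists_extension_completion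
    ((UniformSpace.Completion.toComplL (𝕜 := 𝕜) :
      PreZ X p →L[𝕜] UniformSpace.Completion (PreZ X p)).toLinearMap ∘ₗ
      PreZ.blockMap X p ha hab hbs hst ht) (b - a)⁻¹ (fun f => by
        change ‖((PreZ.blockMap X p ha hab hbs hst ht f : PreZ X p) :
          UniformSpace.Completion (PreZ X p))‖ ≤ _
        rw [UniformSpace.Completion.norm_coe, hBw]
        exact ((PreZ.norm_step_le hp1 (hb0.trans hbs) hst ht (w f)).trans
          (normW_anti hp1 hb0 hbs.le hs1 (PreZ.avg_mem hp1 f ha hab hb1))).trans (havg f))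
  refine ⟨T, ?_, hT⟩
  have htb := totallyBounded_image_step (p := p) hX hXf hb0 hbs hst ht (b - a)⁻¹
  set A := (fun w : spaceW X p s =>
      (PreZ.step X p (hb0.trans hbs) hst ht w : UniformSpace.Completion (PreZ X p))) ''
        {w | (w : E) ∈ spaceW X p b ∧ normW X p b w < (b - a)⁻¹}
  refine (isCompactOperator_iff_exists_mem_nhds_image_subset_compact _).2
    ⟨Metric.ball 0 1, Metric.ball_mem_nhds _ one_pos, closure A,
      htb.closure.isCompact_of_isClosed isClosed_closure, ?_⟩
  rintro _ ⟨z, hz, rfl⟩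
  -- Averages are known only for step functions; these are dense in the open ball, and the closure
  -- of A absorbs the limits.
  have hz' : z ∈ closure (Metric.ball 0 1 ∩
      range ((↑) : PreZ X p → UniformSpace.Completion (PreZ X p))) :=
    UniformSpace.Completion.denseRange_coe.open_subset_closure_inter Metric.isOpen_ball hz
  refine map_mem_closure T.continuous hz' ?_
  rintro _ ⟨hf, f, rfl⟩
  rw [mem_ball_zero_iff, UniformSpace.Completion.norm_coe] at hf
  refine ⟨w f, ⟨PreZ.avg_mem hp1 f ha hab hb1, (havg f).trans_lt ?_⟩, ?_⟩
  · exact mul_lt_of_lt_one_right hba hf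
  · rw [hT]
    exact congrArg _ (hBw f).symm

end Averages

/-! ### The shifted averaging operators and metric compact approximation. -/

section Grid

/-- The points of a grid of mesh `1 / (m + 3)`. -/
def gridPt (m j : ℕ) : ℝ := (j : ℝ) / (m + 3)

lemma gridPt_nonneg (m j : ℕ) : 0 ≤ gridPt m j := by unfold gridPt; positivity

lemma gridPt_strictMono (m : ℕ) : StrictMono (gridPt m) := fun i j h => by
  unfold gridPt
  gcongr

lemma gridPt_lt_one {m j : ℕ} (h : j < m + 3) : gridPt m j < 1 := by
  unfold gridPt
  rw [div_lt_one (by positivity)]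
  exact_mod_cast h

lemma gridPt_succ_sub (m j : ℕ) : gridPt m (j + 1) - gridPt m j = ((m : ℝ) + 3)⁻¹ := by
  unfold gridPt
  rw [← sub_div]
  push_cast
  rw [add_sub_cancel_left, one_div]

lemma pairwise_disjoint_gridPt (m : ℕ) :
    Pairwise (Function.onFun Disjoint fun j => Ioo (gridPt m j) (gridPt m (j + 1))) :=
  (gridPt_strictMono m).monotone.pairwise_disjoint_on_Ioo_succ

variable {𝕜 : Type*} [RCLike 𝕜] {E : Type*} [NormedAddCommGroup E] [NormedSpace 𝕜 E]
  [NormedSpace ℝ E] [IsScalarTower ℝ 𝕜 E] [CompleteSpace E] {X : ℕ → Submodule 𝕜 E} {p : ℝ}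

/-- A step function is locally constant off a finite set. -/
lemma PreZ.ae_eventually_eq (f : PreZ X p) : ∀ᵐ r : ℝ, ∀ᶠ y in 𝓝 r, f.toFun y = f.toFun r := by
  refine PreZ.induction (P := fun f => ∀ᵐ r : ℝ, ∀ᶠ y in 𝓝 r, f.toFun y = f.toFun r)
    (fun s t hs hst ht w => ?_) ?_ (fun f g hf hg => ?_) (fun c f hf => ?_) f
  · have h1 : ∀ᵐ r : ℝ, r ≠ s := by simp [ae_iff]
    have h2 : ∀ᵐ r : ℝ, r ≠ t := by simp [ae_iff]
    filter_upwards [h1, h2] with r hrs hrt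
    rw [PreZ.toFun_step]
    by_cases hr : r ∈ Ioo s t
    · filter_upwards [isOpen_Ioo.mem_nhds hr] with y hy
      rw [indicator_of_mem hr, indicator_of_mem hy]
    · have hr' : r ∈ (Icc s t)ᶜ := fun h => hr ⟨lt_of_le_of_ne h.1 hrs.symm, lt_of_le_of_ne h.2 hrt⟩
      filter_upwards [isClosed_Icc.isOpen_compl.mem_nhds hr'] with y hy
      rw [indicator_of_notMem hr, indicator_of_notMem fun h => hy (Ioo_subset_Icc_self h)]
  · exact Eventually.of_forall fun r => Eventually.of_forall fun y => rfl
  · filter_upwards [hf, hg] with r h1 h2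
    filter_upwards [h1, h2] with y h3 h4
    rw [PreZ.toFun_add, PreZ.toFun_add, h3, h4]
  · filter_upwards [hf] with r h1
    filter_upwards [h1] with y h3
    rw [PreZ.toFun_smul, PreZ.toFun_smul, h3]

variable [hp : Fact (2 < p)]

variable (X p) in
/-- Averages over the intervals of the grid, shifted to the right by two intervals. -/
def PreZ.gridMap (m : ℕ) : PreZ X p →ₗ[𝕜] PreZ X p :=
  ∑ j : Fin m, PreZ.blockMap X p (gridPt_nonneg m j) (gridPt_strictMono m (Nat.lt_succ_self j))
    (gridPt_strictMono m (Nat.lt_succ_self (j + 1))) (gridPt_strictMono m (Nat.lt_succ_self (j + 2)))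
    (gridPt_lt_one (by omega))

lemma PreZ.toFun_gridMap (m : ℕ) (f : PreZ X p) (r : ℝ) :
    (PreZ.gridMap X p m f).toFun r = ∑ j : Fin m,
      (Ioo (gridPt m (j + 2)) (gridPt m (j + 3))).indicator
        (fun _ => f.avg (gridPt m j) (gridPt m (j + 1))) r := by
  rw [PreZ.gridMap, LinearMap.sum_apply, PreZ.toFun_sum]
  rfl

lemma sum_indicator_gridPt {M : Type*} [AddCommMonoid M] {m : ℕ} (c : Fin m → M) {r : ℝ}
    {i : Fin m} (hr : r ∈ Ioo (gridPt m (i + 2)) (gridPt m (i + 3))) :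
    ∑ j : Fin m, (Ioo (gridPt m (j + 2)) (gridPt m (j + 3))).indicator (fun _ => c j) r = c i := by
  rw [Finset.sum_eq_single i, indicator_of_mem hr]
  · intro j _ hj
    refine indicator_of_notMem (fun h => ?_) _
    have hne : (j : ℕ) + 2 ≠ i + 2 := fun h => hj (Fin.ext (by omega))
    exact disjoint_left.1 (pairwise_disjoint_gridPt m hne) h hr
  · intro h
    exact absurd (Finset.mem_univ i) h

lemma PreZ.toFun_gridMap_of_mem {m : ℕ} (f : PreZ X p) {r : ℝ} {i : Fin m}
    (hr : r ∈ Ioo (gridPt m (i + 2)) (gridPt m (i + 3))) :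
    (PreZ.gridMap X p m f).toFun r = f.avg (gridPt m i) (gridPt m (i + 1)) := by
  rw [PreZ.toFun_gridMap]
  exact sum_indicator_gridPt (fun j : Fin m => f.avg (gridPt m j) (gridPt m (j + 1))) hr

lemma PreZ.toFun_gridMap_of_notMem {m : ℕ} (f : PreZ X p) {r : ℝ}
    (hr : ∀ i : Fin m, r ∉ Ioo (gridPt m (i + 2)) (gridPt m (i + 3))) :
    (PreZ.gridMap X p m f).toFun r = 0 := by
  rw [PreZ.toFun_gridMap]
  exact Finset.sum_eq_zero fun i _ => indicator_of_notMem (hr i) _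

lemma PreZ.normW_gridMap_le {m : ℕ} (f : PreZ X p) {r : ℝ} (hr1 : r < 1) {i : Fin m}
    (hr : r ∈ Ioo (gridPt m (i + 2)) (gridPt m (i + 3))) :
    normW X p r ((PreZ.gridMap X p m f).toFun r) ≤
      ((m : ℝ) + 3) * ∫ r in Ioo (gridPt m i) (gridPt m (i + 1)), normW X p r (f.toFun r) := by
  have hp1 : 1 ≤ p := one_le_two.trans hp.out.le
  have hm := gridPt_strictMono m
  have h0 := gridPt_nonneg m i
  have h01 := hm (Nat.lt_succ_self i)
  have h1 : gridPt m (i + 1) < 1 := gridPt_lt_one (by omega)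
  rw [PreZ.toFun_gridMap_of_mem f hr]
  refine (normW_anti hp1 (h0.trans_lt h01) ((hm (Nat.lt_succ_self (i + 1))).trans hr.1).le hr1
    (PreZ.avg_mem hp1 f h0 h01 h1)).trans ?_
  have h := PreZ.normW_avg_le hp1 f h0 h01 h1
  rwa [gridPt_succ_sub, inv_inv] at h

lemma gridPt_Ioo_subset {m j : ℕ} (h : j + 1 ≤ m + 3) :
    Ioo (gridPt m j) (gridPt m (j + 1)) ⊆ Ioo 0 1 := by
  refine Ioo_subset_Ioo (gridPt_nonneg m j) ?_
  unfold gridPt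
  rw [div_le_one (by positivity)]
  exact_mod_cast h

/-- On a target cell the norm is at most the average of the norms over the source cell further left.
Jensen's inequality passes to p-th powers, all cells have the same length, and the source cells are
disjoint in (0,1), so the contributions add up to at most the integral for f. -/
lemma PreZ.norm_gridMap_le (m : ℕ) (f : PreZ X p) : ‖PreZ.gridMap X p m f‖ ≤ ‖f‖ := by
  have hp1 : 1 ≤ p := one_le_two.trans hp.out.le
  have hp0 : 0 < p := by linarith
  have hm3 : (0 : ℝ) < m + 3 := by positivity
  rw [← Real.rpow_le_rpow_iff (norm_nonneg _) (norm_nonneg _) hp0, PreZ.norm_rpow hp1,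
    PreZ.norm_rpow hp1]
  set I : ℕ → Set ℝ := fun j => Ioo (gridPt m j) (gridPt m (j + 1)) with hI
  set c : Fin m → ℝ := fun j => (((m : ℝ) + 3) * ∫ r in I j, normW X p r (f.toFun r)) ^ p with hc
  have hsub : ∀ j : Fin m, I j ⊆ Ioo 0 1 := fun j => gridPt_Ioo_subset (by omega)
  have hsub2 : ∀ j : Fin m, I (j + 2) ⊆ Ioo 0 1 := fun j => gridPt_Ioo_subset (by omega)
  have hc0 : ∀ j, 0 ≤ c j := fun j => Real.rpow_nonneg
    (mul_nonneg hm3.le (integral_nonneg fun r => normW_nonneg _)) _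
  have hindi : ∀ j : Fin m, Integrable ((I (j + 2)).indicator fun _ => c j)
      (volume.restrict (Ioo (0 : ℝ) 1)) := fun j =>
    (integrable_const (c j)).indicator measurableSet_Ioo
  have hvol : ∀ j, volume.real (I j) = ((m : ℝ) + 3)⁻¹ := fun j => by
    rw [Real.volume_real_Ioo_of_le (gridPt_strictMono m (Nat.lt_succ_self j)).le, gridPt_succ_sub]
  have hint : ∀ j : Fin m, ∫ r in Ioo (0 : ℝ) 1, (I (j + 2)).indicator (fun _ => c j) r =
      ((m : ℝ) + 3)⁻¹ * c j := fun j => by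
    rw [setIntegral_indicator measurableSet_Ioo, inter_eq_self_of_subset_right (hsub2 j),
      setIntegral_const, hvol, smul_eq_mul]
  have hjen : ∀ j : Fin m, ((m : ℝ) + 3)⁻¹ * c j ≤ ∫ r in I j, normW X p r (f.toFun r) ^ p :=
    fun j => by
    have h := rpow_average_le (gridPt_strictMono m (Nat.lt_succ_self j)) hp1
      (fun r => normW_nonneg (X := X) (p := p) (t := r) (f.toFun r))
      ((PreZ.integrable_normW hp1 f).mono_set (hsub j))
      (IntegrableOn.mono_set (PreZ.integrable hp1 f) (hsub j))
    rw [gridPt_succ_sub, inv_inv] at h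
    rwa [inv_mul_le_iff₀ hm3]
  calc ∫ r in Ioo (0 : ℝ) 1, normW X p r ((PreZ.gridMap X p m f).toFun r) ^ p
      ≤ ∫ r in Ioo (0 : ℝ) 1, ∑ j : Fin m, (I (j + 2)).indicator (fun _ => c j) r := by
        refine integral_mono_of_nonneg
          (Eventually.of_forall fun r => Real.rpow_nonneg (normW_nonneg _) _)
          (integrable_finsetSum _ fun j _ => hindi j)
          ((ae_restrict_iff' measurableSet_Ioo).2 (Eventually.of_forall fun r hr => ?_))
        by_cases h : ∃ i : Fin m, r ∈ I (i + 2)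
        · obtain ⟨i, hi⟩ := h
          refine le_of_le_of_eq ?_ (sum_indicator_gridPt c hi).symm
          exact Real.rpow_le_rpow (normW_nonneg _) (PreZ.normW_gridMap_le f hr.2 hi) hp0.le
        · push Not at h
          simp only [PreZ.toFun_gridMap_of_notMem f h, normW_zero, Real.zero_rpow hp0.ne']
          exact Finset.sum_nonneg fun j _ => indicator_nonneg (fun _ _ => hc0 j) r
    _ = ∑ j : Fin m, ((m : ℝ) + 3)⁻¹ * c j := by
        rw [integral_finsetSum _ fun j _ => hindi j]
        exact Finset.sum_congr rfl fun j _ => hint j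
    _ ≤ ∑ j : Fin m, ∫ r in I j, normW X p r (f.toFun r) ^ p :=
        Finset.sum_le_sum fun j _ => hjen j
    _ = ∫ r in ⋃ j : Fin m, I j, normW X p r (f.toFun r) ^ p := by
        rw [integral_iUnion_fintype (fun j => measurableSet_Ioo) ?_
          fun j => IntegrableOn.mono_set (PreZ.integrable hp1 f) (hsub j)]
        exact fun i j hij => pairwise_disjoint_gridPt m fun h => hij (Fin.ext h)
    _ ≤ ∫ r in Ioo (0 : ℝ) 1, normW X p r (f.toFun r) ^ p :=
        setIntegral_mono_set (PreZ.integrable hp1 f)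
          (Eventually.of_forall fun r => Real.rpow_nonneg (normW_nonneg _) _)
          (LE.le.eventuallyLE (iUnion_subset hsub))

lemma PreZ.avg_of_forall_eq {a b : ℝ} (hab : a < b) (f : PreZ X p) {w : E}
    (h : ∀ r ∈ Ioo a b, f.toFun r = w) : f.avg a b = w := by
  rw [PreZ.avg, setIntegral_congr_fun (g := fun _ => w) measurableSet_Ioo h, setIntegral_const,
    Real.volume_real_Ioo_of_le hab.le, ← algebraMap_smul 𝕜 (b - a), smul_smul,
    ← RCLike.algebraMap_eq_ofReal, ← map_mul, inv_mul_cancel₀ (sub_pos.2 hab).ne', map_one,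
    one_smul]

/-- Almost every point eventually lies inside an interval to which averages are shifted, and the
interval over which the average is taken is close to it. -/
lemma eventually_exists_gridPt {r : ℝ} (hr : r ∈ Ioo (0 : ℝ) 1) (hri : Irrational r) {δ : ℝ}
    (hδ : 0 < δ) : ∀ᶠ m : ℕ in atTop, ∃ i : Fin m,
      r ∈ Ioo (gridPt m (i + 2)) (gridPt m (i + 3)) ∧
      Ioo (gridPt m i) (gridPt m (i + 1)) ⊆ Metric.ball r δ := by
  have hT : Tendsto (fun m : ℕ => (m : ℝ) + 3) atTop atTop :=
    tendsto_atTop_add_const_right _ _ tendsto_natCast_atTop_atTop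
  -- With q the index of the cell of r, the thresholds ensure in turn q ≥ 2, q < m + 2, and that
  -- three cells are shorter than δ. The source cell then has index q - 2 < m.
  filter_upwards [hT.eventually_ge_atTop (2 / r), hT.eventually_gt_atTop (1 / (1 - r)),
    hT.eventually_gt_atTop (3 / δ)] with m h1 h2 h3
  have hm3 : (0 : ℝ) < m + 3 := by positivity
  have hr1 : 0 < 1 - r := by linarith [hr.2]
  rw [div_le_iff₀ hr.1] at h1
  rw [div_lt_iff₀ hr1] at h2
  rw [div_lt_iff₀ hδ] at h3
  set q := ⌊((m : ℝ) + 3) * r⌋₊ with hq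
  have hq0 : 0 ≤ ((m : ℝ) + 3) * r := mul_nonneg hm3.le hr.1.le
  have hq1 : (q : ℝ) ≤ (m + 3) * r := Nat.floor_le hq0
  have hq2 : (m + 3) * r < (q : ℝ) + 1 := Nat.lt_floor_add_one _
  have hq3 : 2 ≤ q := Nat.le_floor (by exact_mod_cast h1)
  have hq4 : q < m + 2 := by
    have : (q : ℝ) < m + 2 := by linarith
    exact_mod_cast this
  -- Grid points are rational, so an irrational r is never one of them.
  have hlt : (q : ℝ) / (m + 3) < r := by
    refine lt_of_le_of_ne ((div_le_iff₀' hm3).2 hq1) fun h => hri ⟨(q : ℚ) / (m + 3), ?_⟩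
    push_cast
    exact h
  have hlt' : r < ((q : ℝ) + 1) / (m + 3) := (lt_div_iff₀' hm3).2 hq2
  refine ⟨⟨q - 2, by omega⟩, ?_, ?_⟩
  · have e2 : q - 2 + 2 = q := by omega
    have e3 : q - 2 + 3 = q + 1 := by omega
    simp only [e2, e3, gridPt]
    exact ⟨hlt, by push_cast; exact hlt'⟩
  · intro y hy
    simp only [gridPt] at hy
    rw [mem_Ioo, div_lt_iff₀ hm3, lt_div_iff₀ hm3] at hy
    push_cast [Nat.cast_sub hq3] at hy
    have hlt'' : (q : ℝ) < r * (m + 3) := (div_lt_iff₀ hm3).1 hlt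
    rw [Metric.mem_ball, Real.dist_eq, abs_lt]
    constructor
    · nlinarith [hy.1]
    · nlinarith [hy.2]

/-- Almost every r has a neighbourhood on which f is constant. Once the source cell belonging to r
lies in it, the average equals f r, so the integrand is eventually 0; it is dominated by (2C)^p. -/
lemma PreZ.tendsto_gridMap (f : PreZ X p) :
    Tendsto (fun m => ‖PreZ.gridMap X p m f - f‖) atTop (𝓝 0) := by
  have hp1 : 1 ≤ p := one_le_two.trans hp.out.le
  have hp0 : 0 < p := by linarith
  obtain ⟨-, -, C, hC⟩ := stepFunctions_props hp1 f.toFun_mem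
  have hC0 : 0 ≤ C := (normW_nonneg _).trans (hC (1 / 2) ⟨by norm_num, by norm_num⟩)
  have hbound : ∀ m : ℕ, ∀ r ∈ Ioo (0 : ℝ) 1,
      normW X p r ((PreZ.gridMap X p m f).toFun r) ≤ C := by
    intro m r hr
    by_cases h : ∃ i : Fin m, r ∈ Ioo (gridPt m (i + 2)) (gridPt m (i + 3))
    · obtain ⟨i, hi⟩ := h
      refine (PreZ.normW_gridMap_le f hr.2 hi).trans ?_
      have hsub : Ioo (gridPt m i) (gridPt m (i + 1)) ⊆ Ioo 0 1 := gridPt_Ioo_subset (by omega)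
      have hle : ∫ r in Ioo (gridPt m i) (gridPt m (i + 1)), normW X p r (f.toFun r) ≤
          ∫ r in Ioo (gridPt m i) (gridPt m (i + 1)), C :=
        setIntegral_mono_on ((PreZ.integrable_normW hp1 f).mono_set hsub)
          (integrable_const C) measurableSet_Ioo fun r hr => hC r (hsub hr)
      rw [setIntegral_const, Real.volume_real_Ioo_of_le
        (gridPt_strictMono m (Nat.lt_succ_self i)).le, gridPt_succ_sub, smul_eq_mul] at hle
      rwa [← le_inv_mul_iff₀ (by positivity)]
    · push Not at h
      rw [PreZ.toFun_gridMap_of_notMem f h, normW_zero]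
      exact hC0
  have hlim : Tendsto (fun m => ∫ r in Ioo (0 : ℝ) 1,
      normW X p r ((PreZ.gridMap X p m f - f).toFun r) ^ p) atTop
      (𝓝 (∫ r in Ioo (0 : ℝ) 1, (0 : ℝ))) := by
    refine tendsto_integral_of_dominated_convergence (fun _ => (C + C) ^ p)
      (fun m => (PreZ.integrable hp1 _).aestronglyMeasurable) (integrable_const _) (fun m => ?_) ?_
    · refine (ae_restrict_iff' measurableSet_Ioo).2 (Eventually.of_forall fun r hr => ?_)
      rw [Real.norm_of_nonneg (Real.rpow_nonneg (normW_nonneg _) _), PreZ.toFun_sub]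
      refine Real.rpow_le_rpow (normW_nonneg _) ?_ hp0.le
      exact (normW_sub_le hp1 hr.1 hr.2 (PreZ.toFun_mem_spaceW hp1 _ hr)
        (PreZ.toFun_mem_spaceW hp1 _ hr)).trans (add_le_add (hbound m r hr) (hC r hr))
    · refine (ae_restrict_iff' measurableSet_Ioo).2 ?_
      have hirr : ∀ᵐ r : ℝ, Irrational r := by
        rw [ae_iff]
        have : {r : ℝ | ¬ Irrational r} = range ((↑) : ℚ → ℝ) := by
          ext r; simp [Irrational]
        rw [this]
        exact (countable_range _).measure_zero _
      filter_upwards [PreZ.ae_eventually_eq f, hirr] with r hloc hri hr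
      obtain ⟨δ, hδ, hball⟩ := Metric.eventually_nhds_iff_ball.1 hloc
      refine tendsto_const_nhds.congr' ?_
      filter_upwards [eventually_exists_gridPt hr hri hδ] with m ⟨i, hi, hi'⟩
      rw [PreZ.toFun_sub, PreZ.toFun_gridMap_of_mem f hi,
        PreZ.avg_of_forall_eq (gridPt_strictMono m (Nat.lt_succ_self i)) f
          fun y hy => hball y (hi' hy), sub_self, normW_zero, Real.zero_rpow hp0.ne']
  rw [integral_zero] at hlim
  have h := hlim.rpow_const (p := p⁻¹) (Or.inr (by positivity))
  rw [Real.zero_rpow (by positivity)] at h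
  refine h.congr fun m => ?_
  rw [← PreZ.norm_rpow hp1, Real.rpow_rpow_inv (norm_nonneg _) hp0.ne']

lemma PreZ.exists_isCompactOperator_gridMap (hX : Monotone X)
    (hXf : ∀ k, FiniteDimensional 𝕜 (X k)) (m : ℕ) :
    ∃ T : UniformSpace.Completion (PreZ X p) →L[𝕜] UniformSpace.Completion (PreZ X p),
      IsCompactOperator T ∧ ‖T‖ ≤ 1 ∧ ∀ f : PreZ X p, T f = PreZ.gridMap X p m f := by
  have hm := gridPt_strictMono m
  choose T hTc hT using fun j : Fin m =>
    PreZ.exists_isCompactOperator_blockMap (p := p) hX hXf (gridPt_nonneg m j)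
      (hm (Nat.lt_succ_self j)) (hm (Nat.lt_succ_self (j + 1))) (hm (Nat.lt_succ_self (j + 2)))
      (gridPt_lt_one (by omega))
  have hsum : ∀ f : PreZ X p, (∑ j, T j) f = PreZ.gridMap X p m f := fun f => by
    rw [sum_apply, PreZ.gridMap, LinearMap.sum_apply]
    simp only [hT]
    exact (map_sum (UniformSpace.Completion.toComplL (𝕜 := 𝕜) :
      PreZ X p →L[𝕜] UniformSpace.Completion (PreZ X p)) _ _).symm
  refine ⟨∑ j, T j, ?_, ?_, hsum⟩
  · exact Submodule.sum_mem (compactOperator (RingHom.id 𝕜) _ _) fun j _ => hTc j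
  · refine ContinuousLinearMap.opNorm_le_bound _ zero_le_one fun z => ?_
    refine UniformSpace.Completion.induction_on z (isClosed_le ?_ ?_) fun f => ?_
    · exact (∑ j, T j).continuous.norm
    · exact continuous_const.mul continuous_norm
    · rw [hsum, UniformSpace.Completion.norm_coe, UniformSpace.Completion.norm_coe, one_mul]
      exact PreZ.norm_gridMap_le m f

/-- Contractions that converge on a dense subspace converge uniformly on compact sets, by an ε/3
argument over a finite net of step functions. -/
theorem hasMetricCompactAP_completion_preZ (hX : Monotone X)
    (hXf : ∀ k, FiniteDimensional 𝕜 (X k)) :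
    HasMetricCompactAP 𝕜 (UniformSpace.Completion (PreZ X p)) := by
  intro K hK ε hε
  obtain ⟨I, hI⟩ := hK.elim_finite_subcover
    (fun f : PreZ X p => Metric.ball (f : UniformSpace.Completion (PreZ X p)) (ε / 3))
    (fun f => Metric.isOpen_ball) fun z _ => by
      obtain ⟨_, ⟨f, rfl⟩, hf⟩ := Metric.dense_iff.1
        (UniformSpace.Completion.denseRange_coe (α := PreZ X p)) z (ε / 3) (by positivity) |>.imp
          fun _ h => And.symm h
      exact mem_iUnion.2 ⟨f, Metric.mem_ball_comm.1 hf⟩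
  have hev : ∀ᶠ m in atTop, ∀ f ∈ I, ‖PreZ.gridMap X p m f - f‖ < ε / 3 :=
    (eventually_all_finset I).2 fun f _ =>
      (PreZ.tendsto_gridMap f).eventually_lt_const (by positivity)
  obtain ⟨m, hm⟩ := hev.exists
  obtain ⟨T, hTc, hT1, hT⟩ := PreZ.exists_isCompactOperator_gridMap (p := p) hX hXf m
  refine ⟨T, hTc, hT1, fun z hz => ?_⟩
  obtain ⟨f, hf, hzf⟩ := mem_iUnion₂.1 (hI hz)
  rw [Metric.mem_ball, dist_eq_norm] at hzf
  have h1 : ‖T (z - f)‖ ≤ ‖z - f‖ := by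
    simpa using T.le_of_opNorm_le hT1 (z - f)
  have h2 : ‖T (f : UniformSpace.Completion (PreZ X p)) - f‖ < ε / 3 := by
    rw [hT, ← UniformSpace.Completion.coe_sub, UniformSpace.Completion.norm_coe]
    exact hm f hf
  have h3 : T z - z = T (z - f) + (T f - f) - (z - f) := by rw [map_sub]; abel
  rw [h3]
  have h4 := norm_sub_le (T (z - f) + (T f - f)) (z - f)
  have h5 := norm_add_le (T (z - f)) (T f - f)
  linarith

end Grid

/-! ### Final facts and assembly of the theorem. -/

section Main

variable {𝕜 : Type*} [RCLike 𝕜] {Z : Type*} [NormedAddCommGroup Z] [NormedSpace 𝕜 Z]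

lemma HasMetricCompactAP.hasCompactAP (h : HasMetricCompactAP 𝕜 Z) : HasCompactAP 𝕜 Z :=
  fun K hK ε hε => let ⟨T, hT, _, hTK⟩ := h K hK ε hε; ⟨T, hT, hTK⟩

variable {E : Type*} [NormedAddCommGroup E] [NormedSpace 𝕜 E]

lemma spanUpTo_mono (x : ℕ → E) {N : ℕ → ℕ} (hN : Monotone N) : Monotone (spanUpTo 𝕜 x N) :=
  fun _ _ h => Submodule.span_mono (image_mono fun _ hn => lt_of_lt_of_le hn (hN h))

lemma finiteDimensional_spanUpTo (x : ℕ → E) (N : ℕ → ℕ) (k : ℕ) :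
    FiniteDimensional 𝕜 (spanUpTo 𝕜 x N k) :=
  FiniteDimensional.span_of_finite 𝕜 ((finite_lt_nat (N k)).image x)

end Main

end CompactApprox

end

open CompactApprox in
theorem proposition4 {𝕜 : Type*} [RCLike 𝕜] (p : ℝ) [Fact (2 < p)]
    (X : Submodule 𝕜 (lp (fun _ : ℕ => 𝕜) (ENNReal.ofReal p)))
    (hX : IsClosed (X : Set (lp (fun _ : ℕ => 𝕜) (ENNReal.ofReal p))))
    (hAP : ¬ HasAP 𝕜 X) :
    (∃ (x : ℕ → X) (N : ℕ → ℕ), IsAdmissible 𝕜 x N) ∧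
    ∀ (x : ℕ → X) (N : ℕ → ℕ), IsAdmissible 𝕜 x N →
      HasMetricCompactAP 𝕜 (ZSharp 𝕜 p x N) ∧
      HasCompactAP 𝕜 (ZSharp 𝕜 p x N) ∧
      ¬ HasAP 𝕜 (ZSharp 𝕜 p x N) ∧
      IsReflexiveSpace 𝕜 (ZSharp 𝕜 p x N) := by
  have : CompleteSpace X := hX.completeSpace_coe
  refine ⟨exists_isAdmissible hAP, fun x N hx => ?_⟩
  have hM : HasMetricCompactAP 𝕜 (ZSharp 𝕜 p x N) :=
    hasMetricCompactAP_completion_preZ (spanUpTo_mono x hx.strictMono.monotone)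
      (finiteDimensional_spanUpTo x N)
  have hR : IsReflexiveSpace 𝕜 (ZSharp 𝕜 p x N) := by
    -- The inequality involves only two vectors, their sum and their difference, so it restricts
    -- from ℓ^p to the subspace X.
    have hE : ClarksonIneq X p := fun u v =>
      clarksonIneq_lp (u : lp (fun _ : ℕ => 𝕜) (ENNReal.ofReal p)) v
    exact isReflexiveSpace_completion_preZ hE
  have hA : ¬ HasAP 𝕜 (ZSharp 𝕜 p x N) := hx.not_hasAP
  exact ⟨hM, hM.hasCompactAP, hA, hR⟩
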